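/- Let $n\ge 2$ be an integer. For $\underline{\xi}=(\xi_1,\dots,\xi_n)\in\mathbb{R}^n$ and $q>0$ let $K(q)=\{z\in\mathbb{R}^{n+1}: |z_0|\le e^{nq},\ \max_{1\le i\le n}|z_i|\le e^{-q}\}$ and $\Lambda_{\underline{\xi}}=\{(x,\xi_1x-y_1,\dots,\xi_nx-y_n): x,y_1,\dots,y_n\in\mathbb{Z}\}$. Let $\lambda_1(q)\le\dots\le\lambda_{n+1}(q)$ be the successive minima of $K(q)$ with respect to $\Lambda_{\underline{\xi}}$, and put $\varphi_j(q)=\frac{\log\lambda_j(q)}{q}$, $\underline{\varphi}_j=\liminf_{q\to\infty}\varphi_j(q)$ and $\overline{\varphi}_j=\limsup_{q\to\infty}\varphi_j(q)$ for $1\le j\le n+1$. Let $t\in[0,1]$ and $$\mu_0=\mu_0(n,t)=\frac{(3-2n)t+1-2n+\sqrt{(1-t)\,[(4n-5)t+4n^2-4n+1]}}{2(n-1)^2},$$ and let $\mu$ be a real number with $\mu\notin[\mu_0,-t/n]$. Then there is no $\underline{\xi}\in\mathbb{R}^n$ with $\overline{\varphi}_{n+1}=t$, $\underline{\varphi}_1=\mu$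 and $$n\underline{\varphi}_1+\overline{\varphi}_{n+1}=-\underline{\varphi}_{n+1}\left(\frac{n+1}{n-1}+\underline{\varphi}_1+\frac{2}{n-1}\overline{\varphi}_{n+1}\right).$$ In other words, if $n+1+2t+(n-1)\mu\ne 0$, then no $\underline{\xi}\in\mathbb{R}^n$ satisfies $$\overline{\varphi}_{n+1}=t,\qquad \underline{\varphi}_{n+1}=(1-n)\frac{t+n\mu}{n+1+2t+(n-1)\mu},\qquad \underline{\varphi}_1=\mu.$$ -/

import Mathlib

open scoped Pointwise

noncomputable section

namespace ParamGeom

/-- The box `K(q)` of all `(z₀, …, zₙ)` with `|z₀| ≤ e^{nq}` and `max_{1 ≤ i ≤ n} |zᵢ| ≤ e^{-q}`. -/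
def box (n : ℕ) (q : ℝ) : Set (Fin (n + 1) → ℝ) :=
  {z | |z 0| ≤ Real.exp (n * q) ∧ ∀ i : Fin n, |z i.succ| ≤ Real.exp (-q)}

/-- The lattice of all points `(x, ξ₁ x - y₁, …, ξₙ x - yₙ)` with `x, y₁, …, yₙ` integers. -/
def lattice {n : ℕ} (ξ : Fin n → ℝ) : Set (Fin (n + 1) → ℝ) :=
  {z | ∃ (x : ℤ) (y : Fin n → ℤ), z = Fin.cons (x : ℝ) (fun i => ξ i * x - y i)}

/-- The `j`-th successive minimum of `K` with respect to `Λ`: the infimum of all `r > 0` such that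
`r • K` contains `j` linearly independent points of `Λ`. -/
def successiveMin {d : ℕ} (K Λ : Set (Fin d → ℝ)) (j : ℕ) : ℝ :=
  sInf {r : ℝ | 0 < r ∧ ∃ v : Fin j → (Fin d → ℝ),
    LinearIndependent ℝ v ∧ ∀ i, v i ∈ Λ ∧ v i ∈ r • K}

/-- `φ_j(q) = log λ_j(q) / q`, where `λ_j(q)` is the `j`-th successive minimum of the box `K(q)`
with respect to the lattice of `ξ` (meaningful for `1 ≤ j ≤ n + 1` and `q > 0`). -/
def phi {n : ℕ} (ξ : Fin n → ℝ) (j : ℕ) (q : ℝ) : ℝ :=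
  Real.log (successiveMin (box n q) (lattice ξ) j) / q

/-- The lower limit of `φ_j(q)` as `q → ∞`. For `1 ≤ j ≤ n + 1` the function `φ_j` is bounded
for large `q` (`e^{-nq} ≤ λ_j(q) ≤ C e^q`), so this real `liminf` is the usual one. -/
def phiLower {n : ℕ} (ξ : Fin n → ℝ) (j : ℕ) : ℝ :=
  Filter.liminf (phi ξ j) Filter.atTop

/-- The upper limit of `φ_j(q)` as `q → ∞`; `φ_j` is bounded for large `q`. -/
def phiUpper {n : ℕ} (ξ : Fin n → ℝ) (j : ℕ) : ℝ :=
  Filter.limsup (phi ξ j) Filter.atTop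

/-- The bound `μ₀(n, t)`. -/
def mu0 (n : ℕ) (t : ℝ) : ℝ :=
  ((3 - 2 * (n : ℝ)) * t + 1 - 2 * n
    + Real.sqrt ((1 - t) * ((4 * (n : ℝ) - 5) * t + 4 * (n : ℝ) ^ 2 - 4 * n + 1)))
    / (2 * ((n : ℝ) - 1) ^ 2)

/-- Equality holds for `ξ` in the inequality
`n φ̲₁ + φ̄ₙ₊₁ ≤ -φ̲ₙ₊₁ · ((n+1)/(n-1) + φ̲₁ + (2/(n-1)) φ̄ₙ₊₁)`. -/
def SS1Equality {n : ℕ} (ξ : Fin n → ℝ) : Prop :=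
  (n : ℝ) * phiLower ξ 1 + phiUpper ξ (n + 1)
    = -phiLower ξ (n + 1) *
      (((n : ℝ) + 1) / ((n : ℝ) - 1) + phiLower ξ 1 + 2 / ((n : ℝ) - 1) * phiUpper ξ (n + 1))

end ParamGeom

end

/-!
The proof is carried out in the dual picture. For an integer vector `w = (w₀, w')` put
`N_q(w) = max (e^{nq} |w₀ + ξ · w'|, e^{-q} |w'|)`. Up to bounded factors, the last successive minimum
of `K(q)` is the inverse of the smallest `N_q(w)`, and the first one is the inverse of the size of
the largest member of a shortest independent family for `N_q`. This transference
(`exists_linearIndependent_mul_norm_le`) follows from the upper bound in Minkowski's second theorem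
(`exists_linearIndependent_prod_norm_le`) by taking the rows of the adjugate matrix. With
`s = phiLower ξ (n + 1)` and `m = -μ` one has, up to `o(q)` in the exponents:
`N_q(w) ≥ e^{-tq}` for all `w ≠ 0` and all large `q`; some `w ≠ 0` has `N_q(w) ≤ e^{-sq}` for all large
`q`; some `w ≠ 0` has `N_q(w) ≤ e^{-tq}` for arbitrarily large `q`; and `n + 1` independent vectors have
`N_q ≤ e^{mq}` for all large `q`.

The bound `μ ≤ -t/n` holds for every `ξ`: an integer determinant built from a vector realizing `t`
and `n` vectors of size `e^{mq}` is at least `1` (`phiUpper_add_mul_phiLower_nonpos`).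

For `μ ≥ μ₀`, let `x` realize `t` at `q₀`, let `q₁` be the time at which `x` stops satisfying
`N_q(x) ≤ e^{-sq}`, and let `y` be a vector that satisfies it just after `q₁`. The determinant of
`x`, `y` and `n - 1` vectors of size `e^{m q₀}` is at least `1`; this is the Schmidt–Summerer
inequality, and equality means that all the estimates in it are sharp. Then the determinant of `x`,
`y`, a third vector `z` independent of them and `n - 2` others shows `N_{q₀}(z) ≥ e^{m q₀}`. Let `q₂`
be the time at which `y` stops satisfying `N_q(y) ≤ e^{-sq}`. A vector `z` that satisfies it just
after `q₂` cannot lie in the plane of `x` and `y`, because the covolume of that plane grows too fast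
after `q₁`. Hence `e^{(1+m) q₀} ≤ |z'| ≤ e^{(1-s) q₂}`. Since `N_q(x)` and `N_q(y)` always stay above
`e^{-tq}`, the ratios `q₁ / q₀` and `q₂ / q₁` are bounded in terms of `s` and `t`, and
`(1 + m) (1 - t) (n + s)² ≤ (1 - s)² (n + t)²` results (`exponent_inequality_of_parameters`,
`key_inequality`). After elimination of `s` this reads `(1 - μ) (1 - t) ≤ (1 + t + (n - 1) μ)²`, and
`μ₀` is the larger root of that quadratic (`mu0_le_of_key_inequality`).
-/

namespace ParamGeom

open Matrix Filter Topology

/-! ### Integer vectors, linear forms and determinants -/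

/-- The real vector with the given integer coordinates. -/
def toReal {d : ℕ} (v : Fin d → ℤ) : Fin d → ℝ := fun i => (v i : ℝ)

@[simp] lemma toReal_apply {d : ℕ} (v : Fin d → ℤ) (i : Fin d) : toReal v i = (v i : ℝ) := rfl

lemma toReal_eq_zero {d : ℕ} {v : Fin d → ℤ} : toReal v = 0 ↔ v = 0 := by
  constructor
  · intro h
    ext i
    have := congrFun h i
    simpa using this
  · rintro rfl
    ext i
    simp

/-- Minkowski's theorem on linear forms, for the standard integer lattice. -/
lemma exists_int_ne_zero_abs_mulVec_lt {d : ℕ} (R : Matrix (Fin d) (Fin d) ℝ) (hR : R.det ≠ 0)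
    (c : Fin d → ℝ) (hc : ∀ i, 0 < c i) (h : |R.det| < ∏ i, c i) :
    ∃ v : Fin d → ℤ, v ≠ 0 ∧ ∀ i, |(R *ᵥ toReal v) i| < c i := by
  classical
  set S : Set (Fin d → ℝ) := (Matrix.toLin' R) ⁻¹' (Set.univ.pi fun i => Set.Ioo (-c i) (c i))
    with hS
  have hmem : ∀ x, x ∈ S ↔ ∀ i, |(R *ᵥ x) i| < c i := by
    intro x
    simp [hS, abs_lt]
  have hdet : LinearMap.det (Matrix.toLin' R) ≠ 0 := by simpa using hR
  have hvol : MeasureTheory.volume S = ENNReal.ofReal (|R.det|⁻¹ * ∏ i, (2 * c i)) := by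
    rw [hS, MeasureTheory.Measure.addHaar_preimage_linearMap _ hdet, Real.volume_pi_Ioo,
      ENNReal.ofReal_mul (by positivity),
      ENNReal.ofReal_prod_of_nonneg (fun i _ => by have := hc i; positivity)]
    congr 1
    · simp [abs_inv]
    · refine Finset.prod_congr rfl fun i _ => ?_
      congr 1
      ring
  have hfund := ZSpan.isAddFundamentalDomain' (Pi.basisFun ℝ (Fin d)) MeasureTheory.volume
  have : Countable (Submodule.span ℤ (Set.range (Pi.basisFun ℝ (Fin d)))).toAddSubgroup := by
    change Countable (Submodule.span ℤ (Set.range (Pi.basisFun ℝ (Fin d))))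
    infer_instance
  have hconv : Convex ℝ S :=
    (convex_pi fun i _ => convex_Ioo (-c i) (c i)).linear_preimage _
  obtain ⟨x, hx0, hxS⟩ :=
    MeasureTheory.exists_ne_zero_mem_lattice_of_measure_mul_two_pow_lt_measure
      (L := (Submodule.span ℤ (Set.range (Pi.basisFun ℝ (Fin d)))).toAddSubgroup)
      (s := S) hfund (by
        intro x hx
        rw [hmem] at hx ⊢
        intro i
        rw [Matrix.mulVec_neg, Pi.neg_apply, abs_neg]
        exact hx i) hconv (by
        rw [ZSpan.fundamentalDomain_pi_basisFun, Real.volume_pi_Ico, hvol]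
        simp only [sub_zero, ENNReal.ofReal_one, Finset.prod_const_one]
        rw [one_mul, Module.finrank_fin_fun,
          ← ENNReal.ofReal_ofNat 2, ← ENNReal.ofReal_pow (by norm_num)]
        refine (ENNReal.ofReal_lt_ofReal_iff_of_nonneg (by positivity)).2 ?_
        rw [Finset.prod_mul_distrib, Finset.prod_const, Finset.card_univ, Fintype.card_fin]
        have hpos : 0 < |R.det| := abs_pos.2 hR
        rw [inv_mul_eq_div, lt_div_iff₀ hpos]
        have : (0 : ℝ) < 2 ^ d := by positivity
        nlinarith)
  have hx := x.2
  simp only [Submodule.mem_toAddSubgroup] at hx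
  rw [Module.Basis.mem_span_iff_repr_mem] at hx
  choose v hv using hx
  have hvx : toReal v = (x : Fin d → ℝ) := by
    ext i
    have := hv i
    simpa using this
  refine ⟨v, ?_, ?_⟩
  · rintro rfl
    apply hx0
    ext i
    have := congrFun hvx i
    simpa using this.symm
  · rw [hvx]
    exact (hmem _).1 hxS

lemma abs_det_le_factorial_mul_prod_norm {d : ℕ} (u : Fin d → Fin d → ℝ) :
    |(Matrix.of u).det| ≤ d.factorial * ∏ i, ‖u i‖ := by
  rw [Matrix.det_apply]
  refine (Finset.abs_sum_le_sum_abs _ _).trans ?_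
  have : ∀ σ ∈ (Finset.univ : Finset (Equiv.Perm (Fin d))),
      |Equiv.Perm.sign σ • ∏ i, Matrix.of u (σ i) i| ≤ ∏ i, ‖u i‖ := by
    intro σ _
    have h1 : |Equiv.Perm.sign σ • ∏ i, Matrix.of u (σ i) i| = ∏ i, |u (σ i) i| := by
      rw [← Finset.abs_prod]
      rcases Int.units_eq_one_or (Equiv.Perm.sign σ) with h | h <;> simp [h]
    rw [h1, ← Equiv.prod_comp σ (fun i => ‖u i‖)]
    refine Finset.prod_le_prod (fun i _ => abs_nonneg _) fun i _ => ?_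
    exact norm_le_pi_norm (u (σ i)) i
  refine (Finset.sum_le_card_nsmul _ _ _ this).trans ?_
  simp [Finset.card_univ, Fintype.card_perm]

lemma det_of_mulVec {d : ℕ} (g : Matrix (Fin d) (Fin d) ℝ) (u : Fin d → Fin d → ℝ) :
    (Matrix.of fun i => g *ᵥ u i).det = (Matrix.of u).det * g.det := by
  rw [← Matrix.det_transpose g, ← Matrix.det_mul]
  congr 1
  ext i j
  simp [Matrix.mul_apply, Matrix.mulVec, dotProduct, mul_comm]

/-- The coordinate determinant of any family is bounded by the product of the sizes of its members
after a unimodular transformation. -/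
lemma abs_det_le_of_abs_det_eq_one {d : ℕ} {g : Matrix (Fin d) (Fin d) ℝ} (hg : |g.det| = 1)
    (u : Fin d → Fin d → ℝ) :
    |(Matrix.of u).det| ≤ d.factorial * ∏ i, ‖g *ᵥ u i‖ := by
  have := abs_det_le_factorial_mul_prod_norm (fun i => g *ᵥ u i)
  rwa [det_of_mulVec, abs_mul, hg, mul_one] at this

lemma det_ne_zero_of_linearIndependent {d : ℕ} {u : Fin d → Fin d → ℝ}
    (hu : LinearIndependent ℝ u) : (Matrix.of u).det ≠ 0 := by
  have : IsUnit (Matrix.of u) := Matrix.linearIndependent_rows_iff_isUnit.1 hu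
  exact ((Matrix.isUnit_iff_isUnit_det _).1 this).ne_zero

lemma one_le_abs_det_of_linearIndependent {d : ℕ} {v : Fin d → Fin d → ℤ}
    (hv : LinearIndependent ℝ fun i => toReal (v i)) :
    1 ≤ |(Matrix.of fun i => toReal (v i)).det| := by
  have h0 := det_ne_zero_of_linearIndependent hv
  have h1 : (Matrix.of fun i => toReal (v i)).det = ((Matrix.of v).det : ℝ) := by
    have := RingHom.map_det (Int.castRingHom ℝ) (Matrix.of v)
    rw [eq_intCast] at this
    rw [this]
    congr 1
  rw [h1] at h0 ⊢
  exact_mod_cast Int.one_le_abs (by exact_mod_cast h0)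

lemma linearIndependent_toReal_single (d : ℕ) :
    LinearIndependent ℝ fun i : Fin d => toReal (Pi.single i (1 : ℤ)) := by
  have := (Pi.basisFun ℝ (Fin d)).linearIndependent
  convert this using 2 with i
  ext j
  simp [Pi.single_apply]

/-! ### Minkowski's second theorem and transference -/

/-- The Euclidean norm of the image of an integer vector under a matrix. -/
noncomputable def euclideanSize {d : ℕ} (g : Matrix (Fin d) (Fin d) ℝ) (v : Fin d → ℤ) : ℝ :=
  ‖WithLp.toLp 2 (g *ᵥ toReal v)‖

lemma norm_mulVec_le_euclideanSize {d : ℕ} (g : Matrix (Fin d) (Fin d) ℝ) (v : Fin d → ℤ) :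
    ‖g *ᵥ toReal v‖ ≤ euclideanSize g v :=
  (pi_norm_le_iff_of_nonneg (norm_nonneg _)).2 fun i =>
    PiLp.norm_apply_le (WithLp.toLp 2 (g *ᵥ toReal v)) i

lemma linearIndependent_of_det_ne_zero {d : ℕ} {u : Fin d → Fin d → ℝ}
    (hu : (Matrix.of u).det ≠ 0) : LinearIndependent ℝ u :=
  Matrix.linearIndependent_rows_iff_isUnit.2
    ((Matrix.isUnit_iff_isUnit_det _).2 (isUnit_iff_ne_zero.2 hu))

lemma mulVec_ne_zero_of_abs_det_eq_one {d : ℕ} {g : Matrix (Fin d) (Fin d) ℝ}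
    (hg : |g.det| = 1) {v : Fin d → ℤ} (hv : v ≠ 0) : g *ᵥ toReal v ≠ 0 := by
  intro h
  have hdet : g.det ≠ 0 := by
    intro h0
    simp [h0] at hg
  exact hv (toReal_eq_zero.1 (Matrix.eq_zero_of_mulVec_eq_zero hdet h))

lemma euclideanSize_pos {d : ℕ} {g : Matrix (Fin d) (Fin d) ℝ}
    (hg : |g.det| = 1) {v : Fin d → ℤ} (hv : v ≠ 0) : 0 < euclideanSize g v := by
  refine lt_of_lt_of_le (norm_pos_iff.2 (mulVec_ne_zero_of_abs_det_eq_one hg hv))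
    (norm_mulVec_le_euclideanSize g v)

lemma ne_zero_of_linearIndependent_toReal {ι : Type*} {d : ℕ} {v : ι → Fin d → ℤ}
    (hv : LinearIndependent ℝ fun i => toReal (v i)) (i : ι) : v i ≠ 0 := by
  intro h
  exact hv.ne_zero i (toReal_eq_zero.2 h)

lemma one_le_factorial_mul_prod_norm {d : ℕ} {g : Matrix (Fin d) (Fin d) ℝ} (hg : |g.det| = 1)
    {v : Fin d → Fin d → ℤ} (hv : LinearIndependent ℝ fun i => toReal (v i)) :
    1 ≤ d.factorial * ∏ i, ‖g *ᵥ toReal (v i)‖ :=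
  (one_le_abs_det_of_linearIndependent hv).trans (abs_det_le_of_abs_det_eq_one hg _)

/-- A maximal independent family of integer vectors whose product of Euclidean sizes is within a
factor `2` of the infimum, sorted by size. Near-minimality of the product gives the exchange
property: an integer vector that involves `b k` is at least half as large as `b k`. -/
lemma exists_sorted_nearly_minimal {d : ℕ} {g : Matrix (Fin d) (Fin d) ℝ} (hg : |g.det| = 1) :
    ∃ b : Fin d → Fin d → ℤ, LinearIndependent ℝ (fun i => toReal (b i)) ∧
      Monotone (fun i => euclideanSize g (b i)) ∧
      ∀ (v : Fin d → ℤ) (c : Fin d → ℝ), toReal v = ∑ i, c i • toReal (b i) →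
        ∀ k, c k ≠ 0 → euclideanSize g (b k) ≤ 2 * euclideanSize g v := by
  classical
  set P : Set ℝ := {r | ∃ b : Fin d → Fin d → ℤ, LinearIndependent ℝ (fun i => toReal (b i)) ∧
    r = ∏ i, euclideanSize g (b i)} with hP
  have hfac : (0 : ℝ) < d.factorial := by exact_mod_cast d.factorial_pos
  have hlow : ∀ r ∈ P, (1 : ℝ) / d.factorial ≤ r := by
    rintro r ⟨b, hb, rfl⟩
    rw [div_le_iff₀' hfac]
    refine (one_le_factorial_mul_prod_norm hg hb).trans ?_
    gcongr
    exact norm_mulVec_le_euclideanSize _ _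
  have hne : P.Nonempty := ⟨_, _, linearIndependent_toReal_single d, rfl⟩
  have hpos : 0 < sInf P :=
    lt_of_lt_of_le (by positivity) (le_csInf hne hlow)
  obtain ⟨_, ⟨b₀, hb₀, rfl⟩, hlt⟩ := exists_lt_of_csInf_lt hne (show sInf P < 2 * sInf P by linarith)
  set σ := Tuple.sort fun i => euclideanSize g (b₀ i) with hσ
  have hb : LinearIndependent ℝ fun i => toReal (b₀ (σ i)) := hb₀.comp σ σ.injective
  refine ⟨fun i => b₀ (σ i), hb, Tuple.monotone_sort fun i => euclideanSize g (b₀ i), ?_⟩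
  intro v c hv k hk
  set b := fun i => b₀ (σ i) with hbdef
  have hprod : ∏ i, euclideanSize g (b i) = ∏ i, euclideanSize g (b₀ i) :=
    Equiv.prod_comp σ fun i => euclideanSize g (b₀ i)
  have hupd : LinearIndependent ℝ fun i => toReal (Function.update b k v i) := by
    apply linearIndependent_of_det_ne_zero
    have h1 : (Matrix.of fun i => toReal (Function.update b k v i))
        = (Matrix.of fun i => toReal (b i)).updateRow k
          (∑ i, c i • (Matrix.of fun i => toReal (b i)) i) := by
      ext i j
      by_cases hik : i = k
      · subst hik
        have := congrFun hv j
        simpa using this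
      · simp [hik, Matrix.updateRow_apply]
    rw [h1, Matrix.det_updateRow_sum]
    exact smul_ne_zero hk (det_ne_zero_of_linearIndependent hb)
  have hle : sInf P ≤ ∏ i, euclideanSize g (Function.update b k v i) :=
    csInf_le ⟨_, hlow⟩ ⟨_, hupd, rfl⟩
  have h2 : ∏ i, euclideanSize g (Function.update b k v i)
      = euclideanSize g v * ∏ i ∈ Finset.univ \ {k}, euclideanSize g (b i) := by
    rw [← Finset.prod_update_of_mem (Finset.mem_univ k)]
    refine Finset.prod_congr rfl fun i _ => ?_
    by_cases hik : i = k
    · subst hik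
      simp
    · simp [hik]
  have h3 : ∏ i, euclideanSize g (b i)
      = euclideanSize g (b k) * ∏ i ∈ Finset.univ \ {k}, euclideanSize g (b i) := by
    rw [← Finset.prod_update_of_mem (Finset.mem_univ k)]
    simp
  have h4 : 0 < ∏ i ∈ Finset.univ \ {k}, euclideanSize g (b i) :=
    Finset.prod_pos fun i _ => euclideanSize_pos hg (ne_zero_of_linearIndependent_toReal hb i)
  refine le_of_mul_le_mul_right ?_ h4
  rw [← h3, hprod, mul_assoc, ← h2]
  linarith

/-- The upper bound in Minkowski's second theorem, with an unspecified constant: a unimodular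
lattice contains independent vectors whose norms have bounded product. The box adapted to the
Gram–Schmidt frame of a nearly minimal family, with its sides proportional to the sizes of that
family, contains no non-zero lattice point, so its volume is bounded by Minkowski's first theorem. -/
lemma exists_linearIndependent_prod_norm_le {d : ℕ} {g : Matrix (Fin d) (Fin d) ℝ}
    (hg : |g.det| = 1) :
    ∃ b : Fin d → Fin d → ℤ, LinearIndependent ℝ (fun i => toReal (b i)) ∧
      ∏ i, ‖g *ᵥ toReal (b i)‖ ≤ (2 * (d + 1 : ℝ)) ^ d := by
  classical
  obtain ⟨b, hb, hmono, hex⟩ := exists_sorted_nearly_minimal hg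
  refine ⟨b, hb, ?_⟩
  suffices h : ∏ i, euclideanSize g (b i) ≤ (2 * (d + 1 : ℝ)) ^ d from
    (Finset.prod_le_prod (fun i _ => norm_nonneg _)
      fun i _ => norm_mulVec_le_euclideanSize g (b i)).trans h
  by_contra hcon
  push Not at hcon
  set f : Fin d → EuclideanSpace ℝ (Fin d) := fun i => WithLp.toLp 2 (g *ᵥ toReal (b i)) with hf
  set e := InnerProductSpace.gramSchmidtOrthonormalBasis (𝕜 := ℝ)
    (finrank_euclideanSpace (𝕜 := ℝ) (ι := Fin d)) f with he
  set G : Fin d → EuclideanSpace ℝ (Fin d) := fun j => WithLp.toLp 2 (fun i => g i j) with hG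
  set R : Matrix (Fin d) (Fin d) ℝ := Matrix.of fun i j => inner ℝ (e i) (G j) with hR
  have hlin : ∀ x : Fin d → ℝ, WithLp.toLp 2 (g *ᵥ x) = ∑ j, x j • G j := by
    intro x
    ext i
    simp [hG, Matrix.mulVec, dotProduct, mul_comm]
  have hRx : ∀ (x : Fin d → ℝ) i, (R *ᵥ x) i = inner ℝ (e i) (WithLp.toLp 2 (g *ᵥ x)) := by
    intro x i
    rw [hlin, inner_sum]
    simp [hR, Matrix.mulVec, dotProduct, inner_smul_right, mul_comm]
  have hRR : Rᵀ * R = gᵀ * g := by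
    ext j k
    have := e.sum_inner_mul_inner (G j) (G k)
    rw [Matrix.mul_apply, Matrix.mul_apply]
    simp only [Matrix.transpose_apply, hR, Matrix.of_apply]
    calc ∑ i, inner ℝ (e i) (G j) * inner ℝ (e i) (G k)
        = ∑ i, inner ℝ (G j) (e i) * inner ℝ (e i) (G k) := by
          refine Finset.sum_congr rfl fun i _ => ?_
          rw [real_inner_comm]
      _ = inner ℝ (G j) (G k) := this
      _ = _ := by
          simp [hG, PiLp.inner_apply, mul_comm]
  have hdet : |R.det| = 1 := by
    have h := congrArg Matrix.det hRR
    rw [Matrix.det_mul, Matrix.det_mul, Matrix.det_transpose, Matrix.det_transpose] at h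
    have h' : |R.det| * |R.det| = 1 := by rw [← abs_mul, h, abs_mul, hg, one_mul]
    nlinarith [abs_nonneg R.det]
  have hsize : ∀ i, 0 < euclideanSize g (b i) := fun i =>
    euclideanSize_pos hg (ne_zero_of_linearIndependent_toReal hb i)
  obtain ⟨v, hv0, hv⟩ := exists_int_ne_zero_abs_mulVec_lt R
    (by intro h; simp [h] at hdet) (fun i => euclideanSize g (b i) / (2 * (d + 1 : ℝ)))
    (fun i => div_pos (hsize i) (by positivity)) (by
      rw [hdet, Finset.prod_div_distrib, Finset.prod_const, Finset.card_univ, Fintype.card_fin,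
        one_lt_div (by positivity)]
      exact hcon)
  -- expand `v` in the basis `b` and look at the last vector that occurs
  have hspan : toReal v ∈ Submodule.span ℝ (Set.range fun i => toReal (b i)) := by
    have : Submodule.span ℝ (Set.range fun i => toReal (b i)) = ⊤ :=
      hb.span_eq_top_of_card_eq_finrank' (by simp)
    rw [this]
    trivial
  obtain ⟨c, hc⟩ := (Submodule.mem_span_range_iff_exists_fun ℝ).1 hspan
  have hcne : (Finset.univ.filter fun i => c i ≠ 0).Nonempty := by
    by_contra hemp
    rw [Finset.not_nonempty_iff_eq_empty, Finset.filter_eq_empty_iff] at hemp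
    apply hv0
    apply toReal_eq_zero.1
    rw [← hc]
    refine Finset.sum_eq_zero fun i hi => ?_
    have : c i = 0 := by simpa using hemp hi
    simp [this]
  set k := (Finset.univ.filter fun i => c i ≠ 0).max' hcne with hk
  have hck : c k ≠ 0 := by
    have := Finset.max'_mem _ hcne
    simpa using this
  have hck' : ∀ i, k < i → c i = 0 := by
    intro i hi
    by_contra h
    exact absurd (Finset.le_max' _ i (by simpa using h)) (not_le.2 hi)
  have hlow := hex v c hc.symm k hck
  have hcoord : ∀ i, |(R *ᵥ toReal v) i| ≤ euclideanSize g (b k) / (2 * (d + 1 : ℝ)) := by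
    intro i
    rcases le_or_gt i k with hik | hik
    · refine (hv i).le.trans ?_
      gcongr
      exact hmono hik
    · have : (R *ᵥ toReal v) i = 0 := by
        rw [hRx, ← hc, Matrix.mulVec_sum]
        have : WithLp.toLp 2 (∑ j, g *ᵥ (c j • toReal (b j))) = ∑ j, c j • f j := by
          ext l
          simp [hf, Matrix.mulVec_smul]
        rw [this, inner_sum]
        refine Finset.sum_eq_zero fun j _ => ?_
        rcases le_or_gt j k with hjk | hjk
        · rw [inner_smul_right, he,
            InnerProductSpace.gramSchmidtOrthonormalBasis_inv_triangular _ _ (hjk.trans_lt hik),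
            mul_zero]
        · rw [hck' j hjk, zero_smul, inner_zero_right]
      rw [this, abs_zero]
      have := hsize k
      positivity
  have hnorm : euclideanSize g v ≤ ∑ i, |(R *ᵥ toReal v) i| := by
    have h := e.sum_repr' (WithLp.toLp 2 (g *ᵥ toReal v))
    rw [euclideanSize, ← h]
    refine (norm_sum_le _ _).trans (Finset.sum_le_sum fun i _ => ?_)
    rw [norm_smul, e.norm_eq_one, mul_one, hRx, Real.norm_eq_abs]
  have hsum : ∑ i, |(R *ᵥ toReal v) i| ≤ d * (euclideanSize g (b k) / (2 * (d + 1 : ℝ))) := by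
    refine (Finset.sum_le_card_nsmul _ _ _ fun i _ => hcoord i).trans ?_
    simp
  have hlt : (d : ℝ) * (euclideanSize g (b k) / (2 * (d + 1 : ℝ))) < euclideanSize g (b k) / 2 := by
    have h1 := hsize k
    rw [mul_div_assoc', div_lt_div_iff₀ (by positivity) (by norm_num)]
    nlinarith
  linarith

/-- Transference: for a pair of dual unimodular matrices there are two independent families of
integer vectors whose sizes are, index by index, inverse to each other up to a constant. The second
family consists of the rows of the adjugate of the first one. -/
theorem exists_linearIndependent_mul_norm_le (d : ℕ) :
    ∃ C : ℝ, 0 < C ∧ ∀ g g' : Matrix (Fin d) (Fin d) ℝ, gᵀ * g' = 1 → |g.det| = 1 →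
      ∃ b w : Fin d → Fin d → ℤ, LinearIndependent ℝ (fun i => toReal (b i)) ∧
        LinearIndependent ℝ (fun i => toReal (w i)) ∧
        ∀ i, ‖g *ᵥ toReal (b i)‖ * ‖g' *ᵥ toReal (w i)‖ ≤ C := by
  classical
  refine ⟨d.factorial * (2 * (d + 1 : ℝ)) ^ d, by positivity, ?_⟩
  intro g g' hgg hg
  obtain ⟨b, hb, hprod⟩ := exists_linearIndependent_prod_norm_le hg
  set B : Matrix (Fin d) (Fin d) ℤ := Matrix.of b with hB
  set BR : Matrix (Fin d) (Fin d) ℝ := Matrix.of (fun i => toReal (b i)) with hBR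
  have hBmap : BR = B.map (Int.castRingHom ℝ) := rfl
  have hBdet : BR.det ≠ 0 := det_ne_zero_of_linearIndependent hb
  set w : Fin d → Fin d → ℤ := fun i j => B.adjugate j i with hw
  have hW : (Matrix.of fun i => toReal (w i)) = (BR.adjugate)ᵀ := by
    ext i j
    have h := RingHom.map_adjugate (Int.castRingHom ℝ) B
    have h' := congrFun (congrFun h j) i
    simpa [hw, hBmap] using h'
  have hwind : LinearIndependent ℝ fun i => toReal (w i) := by
    apply linearIndependent_of_det_ne_zero
    rw [hW, Matrix.det_transpose, Matrix.det_adjugate]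
    exact pow_ne_zero _ hBdet
  refine ⟨b, w, hb, hwind, fun i => ?_⟩
  -- the rows `g' w i` are, up to sign, the rows of the adjugate of the matrix with rows `g (b j)`
  set M : Matrix (Fin d) (Fin d) ℝ := Matrix.of fun j => g *ᵥ toReal (b j) with hM
  have hMB : M = BR * gᵀ := by
    ext j l
    simp [hM, hBR, Matrix.mul_apply, Matrix.mulVec, dotProduct, mul_comm]
  have hginv : (gᵀ).adjugate = g.det • g' := by
    have h1 : (gᵀ).adjugate * gᵀ = g.det • 1 := by rw [Matrix.adjugate_mul, Matrix.det_transpose]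
    calc (gᵀ).adjugate = (gᵀ).adjugate * (gᵀ * g') := by rw [hgg, mul_one]
      _ = g.det • g' := by rw [← mul_assoc, h1, smul_mul_assoc, one_mul]
  have hentry : ∀ l, g.det * (g' *ᵥ toReal (w i)) l = M.adjugate l i := by
    intro l
    rw [hMB, Matrix.adjugate_mul_distrib, hginv, smul_mul_assoc, Matrix.smul_apply, smul_eq_mul,
      Matrix.mul_apply, Matrix.mulVec, dotProduct]
    congr 1
    refine Finset.sum_congr rfl fun j _ => ?_
    have := congrFun (congrFun hW i) j
    simp only [Matrix.of_apply, Matrix.transpose_apply] at this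
    rw [this]
  have habs : ∀ l, |(g' *ᵥ toReal (w i)) l|
      ≤ d.factorial * ∏ j ∈ Finset.univ \ {i}, ‖g *ᵥ toReal (b j)‖ := by
    intro l
    have h1 : |(g' *ᵥ toReal (w i)) l| = |M.adjugate l i| := by
      rw [← hentry, abs_mul, hg, one_mul]
    rw [h1, Matrix.adjugate_apply]
    have h2 : M.updateRow i (Pi.single l 1)
        = Matrix.of (Function.update (fun j => g *ᵥ toReal (b j)) i (Pi.single l 1)) := rfl
    rw [h2]
    refine (abs_det_le_factorial_mul_prod_norm _).trans (le_of_eq ?_)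
    congr 1
    have h3 : ∏ j, ‖Function.update (fun j => g *ᵥ toReal (b j)) i (Pi.single l 1) j‖
        = ∏ j, Function.update (fun j => ‖g *ᵥ toReal (b j)‖) i 1 j := by
      refine Finset.prod_congr rfl fun j _ => ?_
      by_cases hji : j = i
      · subst hji
        simp [Pi.norm_single]
      · simp [hji]
    rw [h3, Finset.prod_update_of_mem (Finset.mem_univ i), one_mul]
  have hnorm : ‖g' *ᵥ toReal (w i)‖
      ≤ d.factorial * ∏ j ∈ Finset.univ \ {i}, ‖g *ᵥ toReal (b j)‖ :=
    (pi_norm_le_iff_of_nonneg (by positivity)).2 habs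
  have hsplit : ∏ j, ‖g *ᵥ toReal (b j)‖
      = ‖g *ᵥ toReal (b i)‖ * ∏ j ∈ Finset.univ \ {i}, ‖g *ᵥ toReal (b j)‖ := by
    rw [← Finset.prod_update_of_mem (Finset.mem_univ i)]
    simp
  calc ‖g *ᵥ toReal (b i)‖ * ‖g' *ᵥ toReal (w i)‖
      ≤ ‖g *ᵥ toReal (b i)‖ *
        (d.factorial * ∏ j ∈ Finset.univ \ {i}, ‖g *ᵥ toReal (b j)‖) := by gcongr
    _ = d.factorial * ∏ j, ‖g *ᵥ toReal (b j)‖ := by rw [hsplit]; ring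
    _ ≤ _ := by gcongr

/-! ### The box, the lattice and their duals -/

variable {n : ℕ}

/-- The matrix of `(x, y₁, …, yₙ) ↦ (x, ξ₁ x - y₁, …, ξₙ x - yₙ)`, an involution. -/
noncomputable def shear (ξ : Fin n → ℝ) : Matrix (Fin (n + 1)) (Fin (n + 1)) ℝ :=
  Matrix.of fun i j => Fin.cases (if j = 0 then 1 else 0)
    (fun k => if j = 0 then ξ k else if j = k.succ then -1 else 0) i

/-- The factors that carry the box `K(q)` to the unit cube. -/
noncomputable def scaling (n : ℕ) (q : ℝ) : Fin (n + 1) → ℝ :=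
  Fin.cons (Real.exp (-(n * q))) fun _ => Real.exp q

/-- The matrix that carries integer vectors to the points of the lattice of `ξ`, in coordinates for
which `K(q)` is the unit cube. -/
noncomputable def primal (ξ : Fin n → ℝ) (q : ℝ) : Matrix (Fin (n + 1)) (Fin (n + 1)) ℝ :=
  Matrix.diagonal (scaling n q) * shear ξ

/-- The inverse transpose of `primal ξ q`; it describes the dual lattice and the dual box. -/
noncomputable def dual (ξ : Fin n → ℝ) (q : ℝ) : Matrix (Fin (n + 1)) (Fin (n + 1)) ℝ :=
  Matrix.diagonal (scaling n (-q)) * (shear ξ)ᵀ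

/-- The linear form `x₀ + ξ₁ x₁ + ⋯ + ξₙ xₙ`. -/
noncomputable def linForm (ξ : Fin n → ℝ) (x : Fin (n + 1) → ℝ) : ℝ :=
  x 0 + ∑ i, ξ i * x i.succ

/-- The norm on the dual space attached to the parameter `q`:
`max (e^{nq} |x₀ + ξ₁ x₁ + ⋯ + ξₙ xₙ|, e^{-q} max |xᵢ|)`. -/
noncomputable def dualNorm (ξ : Fin n → ℝ) (q : ℝ) (x : Fin (n + 1) → ℝ) : ℝ :=
  ‖dual ξ q *ᵥ x‖

lemma shear_mulVec_zero (ξ : Fin n → ℝ) (x : Fin (n + 1) → ℝ) : (shear ξ *ᵥ x) 0 = x 0 := by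
  simp [shear, Matrix.mulVec, dotProduct]

lemma shear_mulVec_succ (ξ : Fin n → ℝ) (x : Fin (n + 1) → ℝ) (i : Fin n) :
    (shear ξ *ᵥ x) i.succ = ξ i * x 0 - x i.succ := by
  simp [shear, Matrix.mulVec, dotProduct, Fin.sum_univ_succ, sub_eq_add_neg]

lemma shear_transpose_mulVec_zero (ξ : Fin n → ℝ) (x : Fin (n + 1) → ℝ) :
    ((shear ξ)ᵀ *ᵥ x) 0 = linForm ξ x := by
  simp [shear, Matrix.mulVec, dotProduct, Fin.sum_univ_succ, linForm]

lemma shear_transpose_mulVec_succ (ξ : Fin n → ℝ) (x : Fin (n + 1) → ℝ) (i : Fin n) :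
    ((shear ξ)ᵀ *ᵥ x) i.succ = - x i.succ := by
  simp [shear, Matrix.mulVec, dotProduct, Fin.sum_univ_succ]

lemma shear_mul_shear (ξ : Fin n → ℝ) : shear ξ * shear ξ = 1 := by
  apply Matrix.ext_of_mulVec_single
  intro j
  rw [← Matrix.mulVec_mulVec, Matrix.one_mulVec]
  ext i
  refine Fin.cases ?_ (fun k => ?_) i
  · rw [shear_mulVec_zero, shear_mulVec_zero]
  · rw [shear_mulVec_succ, shear_mulVec_succ, shear_mulVec_zero]
    ring

lemma scaling_mul_scaling_neg (n : ℕ) (q : ℝ) (i : Fin (n + 1)) :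
    scaling n q i * scaling n (-q) i = 1 := by
  refine Fin.cases ?_ (fun k => ?_) i
  · simp [scaling, ← Real.exp_add]
  · simp [scaling, ← Real.exp_add]

lemma primal_transpose_mul_dual (ξ : Fin n → ℝ) (q : ℝ) : (primal ξ q)ᵀ * dual ξ q = 1 := by
  rw [primal, dual, Matrix.transpose_mul, Matrix.diagonal_transpose, Matrix.mul_assoc,
    ← Matrix.mul_assoc (Matrix.diagonal _), Matrix.diagonal_mul_diagonal]
  simp only [scaling_mul_scaling_neg, Matrix.diagonal_one, Matrix.one_mul]
  rw [← Matrix.transpose_mul, shear_mul_shear, Matrix.transpose_one]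

lemma abs_det_shear (ξ : Fin n → ℝ) : |(shear ξ).det| = 1 := by
  have h := congrArg Matrix.det (shear_mul_shear ξ)
  rw [Matrix.det_mul, Matrix.det_one] at h
  have h' : |(shear ξ).det| * |(shear ξ).det| = 1 := by rw [← abs_mul, h, abs_one]
  nlinarith [abs_nonneg (shear ξ).det]

lemma prod_scaling (n : ℕ) (q : ℝ) : ∏ i, scaling n q i = 1 := by
  rw [Fin.prod_univ_succ]
  simp [scaling, ← Real.exp_nat_mul, ← Real.exp_add]

lemma abs_det_primal (ξ : Fin n → ℝ) (q : ℝ) : |(primal ξ q).det| = 1 := by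
  rw [primal, Matrix.det_mul, Matrix.det_diagonal, prod_scaling, one_mul, abs_det_shear]

lemma abs_det_dual (ξ : Fin n → ℝ) (q : ℝ) : |(dual ξ q).det| = 1 := by
  rw [dual, Matrix.det_mul, Matrix.det_diagonal, prod_scaling, one_mul, Matrix.det_transpose,
    abs_det_shear]

lemma norm_primal_mulVec_le_iff (ξ : Fin n → ℝ) (q : ℝ) (x : Fin (n + 1) → ℝ) (r : ℝ) :
    ‖primal ξ q *ᵥ x‖ ≤ r ↔
      Real.exp (-(n * q)) * |x 0| ≤ r ∧ ∀ i : Fin n, Real.exp q * |ξ i * x 0 - x i.succ| ≤ r := by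
  rw [pi_norm_le_iff_of_nonempty, Fin.forall_fin_succ, primal, ← Matrix.mulVec_mulVec]
  simp only [Matrix.mulVec_diagonal, shear_mulVec_zero, shear_mulVec_succ, norm_mul,
    Real.norm_eq_abs]
  simp [scaling]

lemma dualNorm_le_iff (ξ : Fin n → ℝ) (q : ℝ) (x : Fin (n + 1) → ℝ) (r : ℝ) :
    dualNorm ξ q x ≤ r ↔
      Real.exp (n * q) * |linForm ξ x| ≤ r ∧ ∀ i : Fin n, Real.exp (-q) * |x i.succ| ≤ r := by
  rw [dualNorm, pi_norm_le_iff_of_nonempty, Fin.forall_fin_succ, dual, ← Matrix.mulVec_mulVec]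
  simp only [Matrix.mulVec_diagonal, shear_transpose_mulVec_zero, shear_transpose_mulVec_succ,
    norm_mul, Real.norm_eq_abs, abs_neg]
  simp [scaling]

/-- The points of the lattice are the images of the integer vectors under the shear. -/
lemma mem_lattice_iff (ξ : Fin n → ℝ) (z : Fin (n + 1) → ℝ) :
    z ∈ lattice ξ ↔ ∃ v : Fin (n + 1) → ℤ, z = shear ξ *ᵥ toReal v := by
  constructor
  · rintro ⟨x, y, rfl⟩
    refine ⟨Fin.cons x y, ?_⟩
    ext i
    refine Fin.cases ?_ (fun k => ?_) i
    · rw [shear_mulVec_zero]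
      simp
    · rw [shear_mulVec_succ]
      simp
  · rintro ⟨v, rfl⟩
    refine ⟨v 0, fun i => v i.succ, ?_⟩
    ext i
    refine Fin.cases ?_ (fun k => ?_) i
    · rw [shear_mulVec_zero]
      simp
    · rw [shear_mulVec_succ]
      simp

lemma shear_mulVec_mem_smul_box_iff (ξ : Fin n → ℝ) (q : ℝ) (x : Fin (n + 1) → ℝ) {r : ℝ}
    (hr : 0 < r) : shear ξ *ᵥ x ∈ r • box n q ↔ ‖primal ξ q *ᵥ x‖ ≤ r := by
  rw [Set.mem_smul_set_iff_inv_smul_mem₀ hr.ne', norm_primal_mulVec_le_iff, box, Set.mem_ofPred_eq]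
  simp only [Pi.smul_apply, smul_eq_mul, shear_mulVec_zero, shear_mulVec_succ, abs_mul, abs_inv,
    abs_of_pos hr]
  refine and_congr ?_ (forall_congr' fun i => ?_)
  · rw [inv_mul_le_iff₀ hr, Real.exp_neg, inv_mul_le_iff₀ (Real.exp_pos _), mul_comm r]
  · rw [inv_mul_le_iff₀ hr, Real.exp_neg, ← div_eq_mul_inv, le_div_iff₀ (Real.exp_pos _),
      mul_comm (Real.exp q)]

/-- The successive minima in terms of integer vectors. -/
lemma successiveMin_eq (ξ : Fin n → ℝ) (q : ℝ) (j : ℕ) :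
    successiveMin (box n q) (lattice ξ) j = sInf {r : ℝ | 0 < r ∧
      ∃ v : Fin j → Fin (n + 1) → ℤ, LinearIndependent ℝ (fun i => toReal (v i)) ∧
        ∀ i, ‖primal ξ q *ᵥ toReal (v i)‖ ≤ r} := by
  have hker : LinearMap.ker (shear ξ).mulVecLin = ⊥ := by
    rw [Matrix.ker_mulVecLin_eq_bot_iff]
    intro v hv
    have := congrArg (shear ξ *ᵥ ·) hv
    simpa [Matrix.mulVec_mulVec, shear_mul_shear] using this
  rw [successiveMin]
  congr 1
  ext r
  refine and_congr_right fun hr => ?_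
  constructor
  · rintro ⟨z, hz, hzm⟩
    choose v hv using fun i => (mem_lattice_iff ξ (z i)).1 (hzm i).1
    refine ⟨v, ?_, fun i => ?_⟩
    · have hcomp : z = (shear ξ).mulVecLin ∘ fun i => toReal (v i) := funext hv
      rw [hcomp] at hz
      exact LinearIndependent.of_comp _ hz
    · rw [← shear_mulVec_mem_smul_box_iff ξ q _ hr, ← hv i]
      exact (hzm i).2
  · rintro ⟨v, hv, hvn⟩
    refine ⟨fun i => shear ξ *ᵥ toReal (v i), hv.map' (shear ξ).mulVecLin hker, fun i => ⟨?_, ?_⟩⟩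
    · exact (mem_lattice_iff _ _).2 ⟨_, rfl⟩
    · exact (shear_mulVec_mem_smul_box_iff ξ q _ hr).2 (hvn i)

lemma successiveMin_le {ξ : Fin n → ℝ} {q r : ℝ} {j : ℕ} (hr : 0 < r)
    {v : Fin j → Fin (n + 1) → ℤ} (hv : LinearIndependent ℝ (fun i => toReal (v i)))
    (h : ∀ i, ‖primal ξ q *ᵥ toReal (v i)‖ ≤ r) :
    successiveMin (box n q) (lattice ξ) j ≤ r := by
  rw [successiveMin_eq]
  exact csInf_le ⟨0, fun x hx => hx.1.le⟩ ⟨hr, v, hv, h⟩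

lemma exp_neg_le_norm_primal_mulVec (ξ : Fin n → ℝ) {q : ℝ} (hq : 0 ≤ q)
    {v : Fin (n + 1) → ℤ} (hv : v ≠ 0) : Real.exp (-(n * q)) ≤ ‖primal ξ q *ᵥ toReal v‖ := by
  have h := (norm_primal_mulVec_le_iff ξ q (toReal v) _).1 le_rfl
  by_cases h0 : v 0 = 0
  · obtain ⟨i, hi⟩ : ∃ i : Fin n, v i.succ ≠ 0 := by
      by_contra hcon
      push Not at hcon
      apply hv
      ext i
      exact Fin.cases h0 hcon i
    have h1 : (1 : ℝ) ≤ |(v i.succ : ℝ)| := by exact_mod_cast Int.one_le_abs hi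
    have h2 := h.2 i
    simp only [toReal_apply, h0, Int.cast_zero, mul_zero, zero_sub, abs_neg] at h2
    have h3 : Real.exp (-(n * q)) ≤ Real.exp q := by
      apply Real.exp_le_exp.2
      have : 0 ≤ (n : ℝ) * q := by positivity
      linarith
    have h4 := Real.exp_pos q
    nlinarith
  · have h1 : (1 : ℝ) ≤ |(v 0 : ℝ)| := by exact_mod_cast Int.one_le_abs h0
    have h2 := h.1
    have h4 := Real.exp_pos (-(n * q))
    simp only [toReal_apply] at h2
    nlinarith

lemma norm_primal_mulVec_single_le (ξ : Fin n → ℝ) {q : ℝ} (hq : 0 ≤ q) (k : Fin (n + 1)) :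
    ‖primal ξ q *ᵥ toReal (Pi.single k (1 : ℤ))‖ ≤ (1 + ‖ξ‖) * Real.exp q := by
  have hone : ∀ i, |toReal (Pi.single k (1 : ℤ)) i| ≤ 1 := by
    intro i
    by_cases hik : i = k
    · subst hik
      simp
    · simp [hik]
  have hexp : 1 ≤ Real.exp q := Real.one_le_exp hq
  have hξ : 0 ≤ ‖ξ‖ := norm_nonneg _
  rw [norm_primal_mulVec_le_iff]
  constructor
  · have h1 : Real.exp (-(n * q)) ≤ 1 := Real.exp_le_one_iff.2 (by
      have : 0 ≤ (n : ℝ) * q := by positivity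
      linarith)
    have := hone 0
    have h2 := abs_nonneg (toReal (Pi.single k (1 : ℤ)) 0)
    have h3 := Real.exp_pos (-(n * q))
    nlinarith
  · intro i
    have h1 : |ξ i * toReal (Pi.single k (1 : ℤ)) 0 - toReal (Pi.single k (1 : ℤ)) i.succ|
        ≤ 1 + ‖ξ‖ := by
      refine (abs_sub _ _).trans ?_
      rw [abs_mul]
      have h2 : |ξ i| ≤ ‖ξ‖ := norm_le_pi_norm ξ i
      have h3 := hone 0
      have h4 := hone i.succ
      have h5 := abs_nonneg (ξ i)
      nlinarith [abs_nonneg (toReal (Pi.single k (1 : ℤ)) 0)]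
    rw [mul_comm]
    gcongr

lemma successiveMin_le_mul_exp (ξ : Fin n → ℝ) {q : ℝ} (hq : 0 ≤ q) {j : ℕ} (hj : j ≤ n + 1) :
    successiveMin (box n q) (lattice ξ) j ≤ (1 + ‖ξ‖) * Real.exp q :=
  successiveMin_le (by positivity)
    ((linearIndependent_toReal_single (n + 1)).comp (Fin.castLE hj) (Fin.castLE_injective hj))
    fun i => norm_primal_mulVec_single_le ξ hq (Fin.castLE hj i)

lemma le_successiveMin {ξ : Fin n → ℝ} {q c : ℝ} {j : ℕ} (hj : j ≤ n + 1)
    (h : ∀ r, 0 < r → ∀ v : Fin j → Fin (n + 1) → ℤ, LinearIndependent ℝ (fun i => toReal (v i)) →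
      (∀ i, ‖primal ξ q *ᵥ toReal (v i)‖ ≤ r) → c ≤ r) :
    c ≤ successiveMin (box n q) (lattice ξ) j := by
  rw [successiveMin_eq]
  refine le_csInf ?_ fun r hr => ?_
  · obtain ⟨M, hM⟩ : ∃ M, ∀ i : Fin j,
        ‖primal ξ q *ᵥ toReal (Pi.single (Fin.castLE hj i) (1 : ℤ))‖ ≤ M := by
      obtain ⟨M, hM⟩ := (Set.finite_range fun i : Fin j =>
        ‖primal ξ q *ᵥ toReal (Pi.single (Fin.castLE hj i) (1 : ℤ))‖).bddAbove
      exact ⟨M, fun i => hM ⟨i, rfl⟩⟩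
    exact ⟨max M 1, by simp, _, (linearIndependent_toReal_single (n + 1)).comp (Fin.castLE hj)
      (Fin.castLE_injective hj), fun i => (hM i).trans (le_max_left _ _)⟩
  · obtain ⟨hr, v, hv, hvr⟩ := hr
    exact h r hr v hv hvr

lemma exp_neg_le_successiveMin (ξ : Fin n → ℝ) {q : ℝ} (hq : 0 ≤ q) {j : ℕ} (hj1 : 1 ≤ j)
    (hj : j ≤ n + 1) : Real.exp (-(n * q)) ≤ successiveMin (box n q) (lattice ξ) j :=
  le_successiveMin hj fun _ _ _ hv hvr =>
    (exp_neg_le_norm_primal_mulVec ξ hq (ne_zero_of_linearIndependent_toReal hv ⟨0, hj1⟩)).trans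
      (hvr _)

lemma successiveMin_eq_exp (ξ : Fin n → ℝ) {q : ℝ} (hq : 0 < q) {j : ℕ} (hj1 : 1 ≤ j)
    (hj : j ≤ n + 1) :
    successiveMin (box n q) (lattice ξ) j = Real.exp (phi ξ j q * q) := by
  rw [phi, div_mul_cancel₀ _ hq.ne', Real.exp_log]
  exact (Real.exp_pos _).trans_le (exp_neg_le_successiveMin ξ hq.le hj1 hj)

lemma neg_le_phi (ξ : Fin n → ℝ) {q : ℝ} (hq : 0 < q) {j : ℕ} (hj1 : 1 ≤ j)
    (hj : j ≤ n + 1) : -(n : ℝ) ≤ phi ξ j q := by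
  have h := exp_neg_le_successiveMin ξ hq.le hj1 hj
  rw [successiveMin_eq_exp ξ hq hj1 hj, Real.exp_le_exp] at h
  by_contra hcon
  push Not at hcon
  nlinarith

lemma phi_le (ξ : Fin n → ℝ) {q : ℝ} (hq : 1 ≤ q) {j : ℕ} (hj1 : 1 ≤ j)
    (hj : j ≤ n + 1) : phi ξ j q ≤ 1 + Real.log (1 + ‖ξ‖) := by
  have hq0 : 0 < q := by linarith
  have hξ : 0 ≤ ‖ξ‖ := norm_nonneg ξ
  have h := successiveMin_le_mul_exp ξ hq0.le hj
  rw [successiveMin_eq_exp ξ hq0 hj1 hj, ← Real.exp_log (show 0 < 1 + ‖ξ‖ by positivity),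
    ← Real.exp_add, Real.exp_le_exp] at h
  have hl : 0 ≤ Real.log (1 + ‖ξ‖) := Real.log_nonneg (by linarith)
  by_contra hcon
  push Not at hcon
  nlinarith

lemma isBoundedUnder_ge_phi (ξ : Fin n → ℝ) {j : ℕ} (hj1 : 1 ≤ j) (hj : j ≤ n + 1) :
    Filter.IsBoundedUnder (· ≥ ·) Filter.atTop (phi ξ j) :=
  Filter.isBoundedUnder_of_eventually_ge
    ((Filter.eventually_gt_atTop 0).mono fun _ hq => neg_le_phi ξ hq hj1 hj)

lemma isBoundedUnder_le_phi (ξ : Fin n → ℝ) {j : ℕ} (hj1 : 1 ≤ j) (hj : j ≤ n + 1) :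
    Filter.IsBoundedUnder (· ≤ ·) Filter.atTop (phi ξ j) :=
  Filter.isBoundedUnder_of_eventually_le
    ((Filter.eventually_ge_atTop 1).mono fun _ hq => phi_le ξ hq hj1 hj)

lemma phiLower_le_phiUpper (ξ : Fin n → ℝ) {j : ℕ} (hj1 : 1 ≤ j) (hj : j ≤ n + 1) :
    phiLower ξ j ≤ phiUpper ξ j :=
  Filter.liminf_le_limsup (isBoundedUnder_le_phi ξ hj1 hj) (isBoundedUnder_ge_phi ξ hj1 hj)

lemma eventually_lt_phi {ξ : Fin n → ℝ} {j : ℕ} (hj1 : 1 ≤ j) (hj : j ≤ n + 1) {c : ℝ}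
    (h : c < phiLower ξ j) : ∀ᶠ q in Filter.atTop, c < phi ξ j q :=
  Filter.eventually_lt_of_lt_liminf h (isBoundedUnder_ge_phi ξ hj1 hj)

lemma eventually_phi_lt {ξ : Fin n → ℝ} {j : ℕ} (hj1 : 1 ≤ j) (hj : j ≤ n + 1) {c : ℝ}
    (h : phiUpper ξ j < c) : ∀ᶠ q in Filter.atTop, phi ξ j q < c :=
  Filter.eventually_lt_of_limsup_lt h (isBoundedUnder_le_phi ξ hj1 hj)

lemma frequently_lt_phi {ξ : Fin n → ℝ} {j : ℕ} (hj1 : 1 ≤ j) (hj : j ≤ n + 1) {c : ℝ}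
    (h : c < phiUpper ξ j) : ∃ᶠ q in Filter.atTop, c < phi ξ j q :=
  Filter.frequently_lt_of_lt_limsup (isBoundedUnder_ge_phi ξ hj1 hj).isCoboundedUnder_le h

/-! ### The exponents in terms of the dual norm -/

lemma dualNorm_pos (ξ : Fin n → ℝ) (q : ℝ) {w : Fin (n + 1) → ℤ} (hw : w ≠ 0) :
    0 < dualNorm ξ q (toReal w) :=
  norm_pos_iff.2 (mulVec_ne_zero_of_abs_det_eq_one (abs_det_dual ξ q) hw)

lemma abs_dotProduct_le (ξ : Fin n → ℝ) (q : ℝ) (x y : Fin (n + 1) → ℝ) :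
    |x ⬝ᵥ y| ≤ (n + 1) * (‖primal ξ q *ᵥ x‖ * dualNorm ξ q y) := by
  have h : x ⬝ᵥ y = (primal ξ q *ᵥ x) ⬝ᵥ (dual ξ q *ᵥ y) := by
    rw [Matrix.dotProduct_mulVec, ← Matrix.vecMul_transpose, Matrix.vecMul_vecMul,
      primal_transpose_mul_dual, Matrix.vecMul_one]
  rw [h, dotProduct]
  refine (Finset.abs_sum_le_sum_abs _ _).trans ?_
  refine (Finset.sum_le_card_nsmul _ _ (‖primal ξ q *ᵥ x‖ * dualNorm ξ q y) fun i _ => ?_).trans ?_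
  · rw [abs_mul]
    exact mul_le_mul (norm_le_pi_norm (primal ξ q *ᵥ x) i) (norm_le_pi_norm (dual ξ q *ᵥ y) i)
      (abs_nonneg _) (norm_nonneg _)
  · simp

/-- The easy half of transference: a non-zero dual vector pairs to a non-zero integer with one of
`n + 1` independent lattice points. -/
lemma one_le_successiveMin_mul_dualNorm (ξ : Fin n → ℝ) (q : ℝ) {w : Fin (n + 1) → ℤ}
    (hw : w ≠ 0) :
    1 ≤ (n + 1) * (successiveMin (box n q) (lattice ξ) (n + 1) * dualNorm ξ q (toReal w)) := by
  have hN := dualNorm_pos ξ q hw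
  have hn : (0 : ℝ) < n + 1 := by positivity
  suffices h : 1 / ((n + 1) * dualNorm ξ q (toReal w))
      ≤ successiveMin (box n q) (lattice ξ) (n + 1) by
    rw [div_le_iff₀ (by positivity)] at h
    linarith
  refine le_successiveMin le_rfl fun r hr v hv hvr => ?_
  obtain ⟨i, hi⟩ : ∃ i, v i ⬝ᵥ w ≠ 0 := by
    by_contra hcon
    push Not at hcon
    have h0 : (Matrix.of fun i => toReal (v i)) *ᵥ toReal w = 0 := by
      ext i
      have := hcon i
      simp only [Matrix.mulVec, dotProduct, Matrix.of_apply, toReal_apply, Pi.zero_apply] at this ⊢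
      exact_mod_cast this
    exact hw (toReal_eq_zero.1
      (Matrix.eq_zero_of_mulVec_eq_zero (det_ne_zero_of_linearIndependent hv) h0))
  have h1 : (1 : ℝ) ≤ |toReal (v i) ⬝ᵥ toReal w| := by
    have h2 : toReal (v i) ⬝ᵥ toReal w = ((v i ⬝ᵥ w : ℤ) : ℝ) := by
      simp [dotProduct]
    rw [h2]
    exact_mod_cast Int.one_le_abs hi
  have h3 := h1.trans (abs_dotProduct_le ξ q _ _)
  rw [div_le_iff₀ (by positivity)]
  have h4 := mul_le_mul_of_nonneg_right (hvr i) hN.le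
  nlinarith

/-- The hard half of transference, for the last and the first successive minimum. -/
lemma exists_successiveMin_mul_dualNorm_le (n : ℕ) :
    ∃ C : ℝ, 0 < C ∧ ∀ (ξ : Fin n → ℝ) (q : ℝ),
      (∃ w : Fin (n + 1) → ℤ, w ≠ 0 ∧
        successiveMin (box n q) (lattice ξ) (n + 1) * dualNorm ξ q (toReal w) ≤ C) ∧
      ∃ W : Fin (n + 1) → Fin (n + 1) → ℤ, LinearIndependent ℝ (fun i => toReal (W i)) ∧
        ∀ i, successiveMin (box n q) (lattice ξ) 1 * dualNorm ξ q (toReal (W i)) ≤ C := by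
  obtain ⟨C, hC, hT⟩ := exists_linearIndependent_mul_norm_le (n + 1)
  refine ⟨C, hC, fun ξ q => ?_⟩
  obtain ⟨b, W, hb, hW, hbW⟩ := hT _ _ (primal_transpose_mul_dual ξ q) (abs_det_primal ξ q)
  have hpos : ∀ i, 0 < ‖primal ξ q *ᵥ toReal (b i)‖ := fun i =>
    norm_pos_iff.2 (mulVec_ne_zero_of_abs_det_eq_one (abs_det_primal ξ q)
      (ne_zero_of_linearIndependent_toReal hb i))
  constructor
  · obtain ⟨j, hj⟩ := Finite.exists_max fun i => ‖primal ξ q *ᵥ toReal (b i)‖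
    refine ⟨W j, ne_zero_of_linearIndependent_toReal hW j, le_trans ?_ (hbW j)⟩
    exact mul_le_mul_of_nonneg_right (successiveMin_le (hpos j) hb hj) (norm_nonneg _)
  · refine ⟨W, hW, fun i => le_trans ?_ (hbW i)⟩
    refine mul_le_mul_of_nonneg_right ?_ (norm_nonneg _)
    refine successiveMin_le (hpos i) (v := fun _ : Fin 1 => b i) ?_ fun _ => le_rfl
    exact linearIndependent_unique_iff.2 (hb.ne_zero i)

lemma eventually_le_exp_mul (C : ℝ) {δ : ℝ} (hδ : 0 < δ) : ∀ᶠ q in atTop, C ≤ Real.exp (δ * q) :=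
  (Real.tendsto_exp_atTop.comp (tendsto_id.const_mul_atTop hδ)).eventually_ge_atTop C

lemma eventually_exp_le_dualNorm {ξ : Fin n → ℝ} {τ : ℝ} (h : phiUpper ξ (n + 1) < τ) :
    ∀ᶠ q in atTop, ∀ w : Fin (n + 1) → ℤ, w ≠ 0 → Real.exp (-τ * q) ≤ dualNorm ξ q (toReal w) := by
  obtain ⟨c, hc, hcτ⟩ := exists_between h
  filter_upwards [eventually_phi_lt (by omega) le_rfl hc, eventually_gt_atTop 0,
    eventually_le_exp_mul (n + 1) (sub_pos.2 hcτ)] with q hφ hq hexp w hw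
  have h1 := one_le_successiveMin_mul_dualNorm ξ q hw
  have hN := dualNorm_pos ξ q hw
  rw [successiveMin_eq_exp ξ hq (by omega) le_rfl] at h1
  have h2 : Real.exp (phi ξ (n + 1) q * q) ≤ Real.exp (c * q) := by
    apply Real.exp_le_exp.2
    gcongr
  have h3 : 1 ≤ Real.exp (τ * q) * dualNorm ξ q (toReal w) := by
    calc 1 ≤ (n + 1) * (Real.exp (phi ξ (n + 1) q * q) * dualNorm ξ q (toReal w)) := h1
      _ ≤ Real.exp ((τ - c) * q) * (Real.exp (c * q) * dualNorm ξ q (toReal w)) := by gcongr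
      _ = _ := by rw [← mul_assoc, ← Real.exp_add]; ring_nf
  rw [neg_mul, Real.exp_neg, inv_le_iff_one_le_mul₀' (Real.exp_pos _)]
  exact h3

lemma le_exp_of_exp_mul_le {C σ c q φ N : ℝ} (hq : 0 < q) (hN : 0 ≤ N)
    (hφ : c < φ) (hexp : C ≤ Real.exp ((c - σ) * q)) (h : Real.exp (φ * q) * N ≤ C) :
    N ≤ Real.exp (-σ * q) := by
  have h1 : Real.exp (c * q) * N ≤ Real.exp (c * q) * Real.exp (-σ * q) := by
    calc Real.exp (c * q) * N ≤ Real.exp (φ * q) * N := by gcongr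
      _ ≤ C := h
      _ ≤ Real.exp ((c - σ) * q) := hexp
      _ = _ := by rw [← Real.exp_add]; ring_nf
  exact le_of_mul_le_mul_left h1 (Real.exp_pos _)

lemma eventually_exists_dualNorm_le_of_lt_phi (ξ : Fin n → ℝ) {σ c : ℝ} (hσ : σ < c) :
    ∀ᶠ q in atTop, c < phi ξ (n + 1) q →
      ∃ w : Fin (n + 1) → ℤ, w ≠ 0 ∧ dualNorm ξ q (toReal w) ≤ Real.exp (-σ * q) := by
  obtain ⟨C, -, hT⟩ := exists_successiveMin_mul_dualNorm_le n
  filter_upwards [eventually_gt_atTop 0, eventually_le_exp_mul C (sub_pos.2 hσ)] with q hq hexp hφ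
  obtain ⟨⟨w, hw, hwC⟩, -⟩ := hT ξ q
  rw [successiveMin_eq_exp ξ hq (by omega) le_rfl] at hwC
  exact ⟨w, hw, le_exp_of_exp_mul_le hq (norm_nonneg _) hφ hexp hwC⟩

lemma eventually_exists_dualNorm_le {ξ : Fin n → ℝ} {σ : ℝ} (h : σ < phiLower ξ (n + 1)) :
    ∀ᶠ q in atTop, ∃ w : Fin (n + 1) → ℤ, w ≠ 0 ∧
      dualNorm ξ q (toReal w) ≤ Real.exp (-σ * q) := by
  obtain ⟨c, hσc, hc⟩ := exists_between h
  filter_upwards [eventually_lt_phi (by omega) le_rfl hc,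
    eventually_exists_dualNorm_le_of_lt_phi ξ hσc] with q hφ hq
  exact hq hφ

lemma frequently_exists_dualNorm_le {ξ : Fin n → ℝ} {σ : ℝ} (h : σ < phiUpper ξ (n + 1)) :
    ∃ᶠ q in atTop, ∃ w : Fin (n + 1) → ℤ, w ≠ 0 ∧
      dualNorm ξ q (toReal w) ≤ Real.exp (-σ * q) := by
  obtain ⟨c, hσc, hc⟩ := exists_between h
  refine ((frequently_lt_phi (by omega) le_rfl hc).and_eventually
    (eventually_exists_dualNorm_le_of_lt_phi ξ hσc)).mono ?_
  rintro q ⟨hφ, hq⟩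
  exact hq hφ

lemma eventually_exists_linearIndependent_dualNorm_le {ξ : Fin n → ℝ} {ν : ℝ}
    (h : ν < phiLower ξ 1) :
    ∀ᶠ q in atTop, ∃ W : Fin (n + 1) → Fin (n + 1) → ℤ,
      LinearIndependent ℝ (fun i => toReal (W i)) ∧
        ∀ i, dualNorm ξ q (toReal (W i)) ≤ Real.exp (-ν * q) := by
  obtain ⟨C, -, hT⟩ := exists_successiveMin_mul_dualNorm_le n
  obtain ⟨c, hνc, hc⟩ := exists_between h
  filter_upwards [eventually_lt_phi le_rfl (by omega) hc, eventually_gt_atTop 0,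
    eventually_le_exp_mul C (sub_pos.2 hνc)] with q hφ hq hexp
  obtain ⟨-, W, hW, hWC⟩ := hT ξ q
  refine ⟨W, hW, fun i => ?_⟩
  have := hWC i
  rw [successiveMin_eq_exp ξ hq le_rfl (by omega)] at this
  exact le_exp_of_exp_mul_le hq (norm_nonneg _) hφ hexp this

/-- The last successive minimum is bounded below, because the determinant of `n + 1` independent
lattice points is at least `1`. -/
lemma phiLower_last_nonneg (ξ : Fin n → ℝ) : 0 ≤ phiLower ξ (n + 1) := by
  refine le_of_forall_lt fun c hc => ?_
  have hfac : (0 : ℝ) < (n + 1).factorial := by exact_mod_cast (n + 1).factorial_pos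
  have hlow : ∀ q, ((n + 1).factorial : ℝ)⁻¹ ≤ successiveMin (box n q) (lattice ξ) (n + 1) := by
    intro q
    refine le_successiveMin le_rfl fun r hr v hv hvr => ?_
    by_contra hcon
    push Not at hcon
    have hfac1 : (1 : ℝ) ≤ (n + 1).factorial := by exact_mod_cast (n + 1).factorial_pos
    have hr1 : r ≤ 1 := hcon.le.trans (inv_le_one_of_one_le₀ hfac1)
    have h1 := one_le_factorial_mul_prod_norm (abs_det_primal ξ q) hv
    have h2 : ∏ i, ‖primal ξ q *ᵥ toReal (v i)‖ ≤ r ^ (n + 1) := by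
      refine (Finset.prod_le_prod (fun i _ => norm_nonneg _) fun i _ => hvr i).trans (le_of_eq ?_)
      simp
    have h3 : r ^ (n + 1) ≤ r := pow_le_of_le_one hr.le hr1 (by omega)
    have h4 : (n + 1).factorial * r < 1 := by
      rw [lt_inv_comm₀ hr hfac] at hcon
      calc (n + 1).factorial * r < r⁻¹ * r := by gcongr
        _ = 1 := inv_mul_cancel₀ hr.ne'
    nlinarith
  obtain ⟨c', hcc', hc'⟩ := exists_between hc
  refine lt_of_lt_of_le hcc' (le_liminf_of_le
    (isBoundedUnder_le_phi ξ (by omega) le_rfl).isCoboundedUnder_ge ?_)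
  filter_upwards [eventually_gt_atTop 0,
    eventually_le_exp_mul (n + 1).factorial (show 0 < -c' by linarith)] with q hq hexp
  by_contra hcon
  push Not at hcon
  have h1 := hlow q
  rw [successiveMin_eq_exp ξ hq (by omega) le_rfl] at h1
  have h2 : Real.exp (phi ξ (n + 1) q * q) < Real.exp (c' * q) := by
    apply Real.exp_lt_exp.2
    gcongr
  rw [neg_mul, Real.exp_neg, le_inv_comm₀ hfac (Real.exp_pos _)] at hexp
  linarith

/-! ### Exchange and integer determinants -/

/-- Steinitz exchange for integer vectors: an independent family is completed to a full one by
members of a given full family. -/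
lemma exists_linearIndependent_extension {d : ℕ} {W : Fin d → Fin d → ℤ}
    (hW : LinearIndependent ℝ fun i => toReal (W i)) (r : ℕ) :
    ∀ (k : ℕ) (h : k + r = d) (v : Fin k → Fin d → ℤ),
      LinearIndependent ℝ (fun i => toReal (v i)) →
      ∃ v' : Fin d → Fin d → ℤ, LinearIndependent ℝ (fun i => toReal (v' i)) ∧
        (∀ i : Fin k, v' (Fin.castLE (by omega) i) = v i) ∧
        ∀ i : Fin d, k ≤ i → ∃ j, v' i = W j := by
  induction r with
  | zero =>
    intro k h v hv
    obtain rfl : k = d := by omega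
    exact ⟨v, hv, fun i => rfl, fun i hi => absurd i.2 (by omega)⟩
  | succ r ih =>
    intro k h v hv
    obtain ⟨j, hj⟩ : ∃ j, toReal (W j) ∉ Submodule.span ℝ (Set.range fun i => toReal (v i)) := by
      by_contra hcon
      push Not at hcon
      have h1 : Submodule.span ℝ (Set.range fun i => toReal (W i)) = ⊤ :=
        hW.span_eq_top_of_card_eq_finrank' (by simp)
      have h2 : Submodule.span ℝ (Set.range fun i => toReal (v i)) = ⊤ := by
        rw [eq_top_iff, ← h1, Submodule.span_le]
        rintro _ ⟨i, rfl⟩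
        exact hcon i
      have h3 := finrank_span_eq_card hv
      rw [h2, finrank_top] at h3
      simp at h3
      omega
    have hsnoc : (fun i => toReal (Fin.snoc (α := fun _ => Fin d → ℤ) v (W j) i))
        = Fin.snoc (α := fun _ => Fin d → ℝ) (fun i => toReal (v i)) (toReal (W j)) := by
      ext i : 1
      refine Fin.lastCases ?_ (fun i => ?_) i <;> simp
    obtain ⟨v', hv', hval, hrest⟩ := ih (k + 1) (by omega)
      (Fin.snoc (α := fun _ => Fin d → ℤ) v (W j)) (by
        rw [hsnoc]
        exact linearIndependent_finSnoc.2 ⟨hv, hj⟩)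
    refine ⟨v', hv', fun i => ?_, fun i hi => ?_⟩
    · have := hval i.castSucc
      rw [Fin.snoc_castSucc] at this
      exact this
    · rcases Nat.eq_or_lt_of_le hi with h' | h'
      · refine ⟨j, ?_⟩
        have := hval (Fin.last k)
        rw [Fin.snoc_last] at this
        rw [← this]
        congr 1
        ext
        simp [h']
      · exact hrest i h'

/-- Independent integer vectors together with enough members of a full family of size at most `ρ`
have determinant at least `1`. -/
lemma one_le_prod_norm_mul_pow {d : ℕ} {g : Matrix (Fin d) (Fin d) ℝ} (hg : |g.det| = 1)
    {W : Fin d → Fin d → ℤ} (hW : LinearIndependent ℝ fun i => toReal (W i)) {ρ : ℝ}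
    (hρ : ∀ i, ‖g *ᵥ toReal (W i)‖ ≤ ρ) {k r : ℕ} (h : k + r = d) {v : Fin k → Fin d → ℤ}
    (hv : LinearIndependent ℝ fun i => toReal (v i)) :
    1 ≤ d.factorial * ((∏ i, ‖g *ᵥ toReal (v i)‖) * ρ ^ r) := by
  obtain ⟨v', hv', hval, hrest⟩ := exists_linearIndependent_extension hW r k h v hv
  refine (one_le_factorial_mul_prod_norm hg hv').trans ?_
  gcongr
  subst h
  rw [Fin.prod_univ_add]
  gcongr with i _
  · rw [← hval i]
    rfl
  · refine (Finset.prod_le_prod (fun i _ => norm_nonneg _) (g := fun _ => ρ) fun i _ => ?_).trans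
      (le_of_eq (by simp))
    obtain ⟨j, hj⟩ := hrest (Fin.natAdd k i) (by simp)
    rw [hj]
    exact hρ j

/-- If an integer vector `z` lies in the plane of two integer vectors `x` and `y`, but not on the
line of `y`, then its `x`-coordinate is bounded below in terms of the sizes of `x` and `y`. -/
lemma one_le_abs_mul_of_eq_smul_add_smul {d : ℕ} {g : Matrix (Fin d) (Fin d) ℝ}
    (hg : |g.det| = 1) {W : Fin d → Fin d → ℤ} (hW : LinearIndependent ℝ fun i => toReal (W i))
    {ρ : ℝ} (hρ : ∀ i, ‖g *ᵥ toReal (W i)‖ ≤ ρ) {r : ℕ} (h : 2 + r = d) {x y z : Fin d → ℤ}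
    (hzy : LinearIndependent ℝ ![toReal z, toReal y]) {α β : ℝ}
    (hz : toReal z = α • toReal x + β • toReal y) :
    1 ≤ |α| * (d.factorial * (‖g *ᵥ toReal x‖ * ‖g *ᵥ toReal y‖ * ρ ^ r)) := by
  obtain ⟨v', hv', hval, hrest⟩ := exists_linearIndependent_extension hW r 2 h ![z, y] (by
    convert hzy using 1
    ext i : 1
    fin_cases i <;> rfl)
  subst h
  set o : Fin (2 + r) := Fin.castAdd r 0 with ho
  set p : Fin (2 + r) := Fin.castAdd r 1 with hp
  have hop : o ≠ p := by
    intro h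
    simp [ho, hp] at h
  have h0 : v' o = z := hval 0
  have h1 : v' p = y := hval 1
  set M : Matrix (Fin (2 + r)) (Fin (2 + r)) ℝ := Matrix.of fun i => toReal (v' i) with hM
  have hMo : M o = toReal z := by rw [hM, ← h0]; rfl
  have hMp : M p = toReal y := by rw [hM, ← h1]; rfl
  set u : Fin (2 + r) → Fin (2 + r) → ℝ := Function.update (fun i => toReal (v' i)) o (toReal x)
    with hu
  have hdet : M.det = α * (Matrix.of u).det := by
    have e1 : M = M.updateRow o (α • toReal x + β • M p) := by
      rw [hMp, ← hz, ← hMo, Matrix.updateRow_eq_self]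
    have e2 : (M.updateRow o (M p)).det = 0 := Matrix.det_updateRow_eq_zero hop.symm
    have e3 : M.updateRow o (toReal x) = Matrix.of u := rfl
    rw [e1, Matrix.det_updateRow_add, Matrix.det_updateRow_smul, Matrix.det_updateRow_smul, e2, e3,
      mul_zero, add_zero]
  refine (one_le_abs_det_of_linearIndependent hv').trans ?_
  rw [← hM, hdet, abs_mul]
  gcongr
  refine (abs_det_le_of_abs_det_eq_one hg u).trans ?_
  gcongr
  rw [Fin.prod_univ_add, Fin.prod_univ_two]
  have hu0 : u (Fin.castAdd r 0) = toReal x := by rw [hu, ← ho, Function.update_self]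
  have hu1 : u (Fin.castAdd r 1) = toReal y := by
    rw [hu, ← hp, Function.update_of_ne hop.symm, h1]
  rw [hu0, hu1]
  gcongr
  refine (Finset.prod_le_prod (fun i _ => norm_nonneg _) (g := fun _ => ρ) fun i _ => ?_).trans
    (le_of_eq (by simp))
  obtain ⟨j, hj⟩ := hrest (Fin.natAdd 2 i) (by simp)
  have hne : Fin.natAdd 2 i ≠ o := by
    intro h
    have := congrArg Fin.val h
    simp [ho] at this
  rw [hu, Function.update_of_ne hne, hj]
  exact hρ j

/-! ### The dual norm in exponential form -/

lemma dualNorm_le_exp_iff (ξ : Fin n → ℝ) (q : ℝ) (x : Fin (n + 1) → ℝ) (c : ℝ) :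
    dualNorm ξ q x ≤ Real.exp c ↔
      |linForm ξ x| ≤ Real.exp (c - n * q) ∧ ∀ i : Fin n, |x i.succ| ≤ Real.exp (c + q) := by
  rw [dualNorm_le_iff]
  refine and_congr ?_ (forall_congr' fun i => ?_)
  · rw [Real.exp_sub, le_div_iff₀' (Real.exp_pos _)]
  · rw [Real.exp_neg, inv_mul_le_iff₀ (Real.exp_pos _), ← Real.exp_add, add_comm q]

lemma exp_le_dualNorm_dichotomy {ξ : Fin n → ℝ} {q : ℝ} {x : Fin (n + 1) → ℝ} {c : ℝ}
    (h : Real.exp c ≤ dualNorm ξ q x) (hlin : |linForm ξ x| < Real.exp (c - n * q)) :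
    ∃ i : Fin n, Real.exp (c + q) ≤ |x i.succ| := by
  by_contra hcon
  push Not at hcon
  have h1 : dualNorm ξ q x < Real.exp c := by
    rw [dualNorm, pi_norm_lt_iff (Real.exp_pos _), Fin.forall_fin_succ, dual,
      ← Matrix.mulVec_mulVec]
    simp only [Matrix.mulVec_diagonal, shear_transpose_mulVec_zero, shear_transpose_mulVec_succ,
      norm_mul, Real.norm_eq_abs, abs_neg]
    refine ⟨?_, fun i => ?_⟩
    · rw [Real.exp_sub, lt_div_iff₀' (Real.exp_pos _)] at hlin
      simpa [scaling] using hlin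
    · have h2 := hcon i
      rw [Real.exp_add, ← div_lt_iff₀ (Real.exp_pos _), div_eq_mul_inv, ← Real.exp_neg,
        mul_comm] at h2
      simpa [scaling] using h2
  exact absurd h (not_le.2 h1)

lemma linForm_smul_add_smul (ξ : Fin n → ℝ) (α β : ℝ) (x y : Fin (n + 1) → ℝ) :
    linForm ξ (α • x + β • y) = α * linForm ξ x + β * linForm ξ y := by
  simp only [linForm, Pi.add_apply, Pi.smul_apply, smul_eq_mul, mul_add, Finset.sum_add_distrib,
    Finset.mul_sum]
  have h1 : ∀ (γ : ℝ) (w : Fin (n + 1) → ℝ),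
      ∑ i, ξ i * (γ * w i.succ) = ∑ i, γ * (ξ i * w i.succ) :=
    fun γ w => Finset.sum_congr rfl fun i _ => by ring
  rw [h1, h1]
  ring

lemma linForm_smul (ξ : Fin n → ℝ) (β : ℝ) (y : Fin (n + 1) → ℝ) :
    linForm ξ (β • y) = β * linForm ξ y := by
  simpa using linForm_smul_add_smul ξ β 0 y 0

lemma dualNorm_smul (ξ : Fin n → ℝ) (q β : ℝ) (y : Fin (n + 1) → ℝ) :
    dualNorm ξ q (β • y) = |β| * dualNorm ξ q y := by
  rw [dualNorm, Matrix.mulVec_smul, norm_smul, Real.norm_eq_abs, dualNorm]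

/-- If all dual norms at `q` are bounded below, one of them is minimal up to a factor `2`, and it
can be taken no larger than a given one. -/
lemma exists_nearly_minimal_dualNorm {ξ : Fin n → ℝ} {q c B : ℝ} (hc : 0 < c)
    (hlow : ∀ w : Fin (n + 1) → ℤ, w ≠ 0 → c ≤ dualNorm ξ q (toReal w))
    (hB : ∃ w : Fin (n + 1) → ℤ, w ≠ 0 ∧ dualNorm ξ q (toReal w) ≤ B) :
    ∃ y : Fin (n + 1) → ℤ, y ≠ 0 ∧ dualNorm ξ q (toReal y) ≤ B ∧
      ∀ w : Fin (n + 1) → ℤ, w ≠ 0 → dualNorm ξ q (toReal y) ≤ 2 * dualNorm ξ q (toReal w) := by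
  set P : Set ℝ := {r | ∃ w : Fin (n + 1) → ℤ, w ≠ 0 ∧ r = dualNorm ξ q (toReal w)} with hP
  have hlow' : ∀ r ∈ P, c ≤ r := by
    rintro r ⟨w, hw, rfl⟩
    exact hlow w hw
  obtain ⟨w₀, hw₀, hw₀B⟩ := hB
  have hne : P.Nonempty := ⟨_, w₀, hw₀, rfl⟩
  have hpos : 0 < sInf P := hc.trans_le (le_csInf hne hlow')
  obtain ⟨_, ⟨y, hy, rfl⟩, hlt⟩ := exists_lt_of_csInf_lt hne (show sInf P < 2 * sInf P by linarith)
  have hy2 : ∀ w : Fin (n + 1) → ℤ, w ≠ 0 →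
      dualNorm ξ q (toReal y) ≤ 2 * dualNorm ξ q (toReal w) := by
    intro w hw
    have : sInf P ≤ dualNorm ξ q (toReal w) := csInf_le ⟨c, hlow'⟩ ⟨w, hw, rfl⟩
    linarith
  rcases le_total (dualNorm ξ q (toReal y)) (dualNorm ξ q (toReal w₀)) with h | h
  · exact ⟨y, hy, h.trans hw₀B, hy2⟩
  · exact ⟨w₀, hw₀, hw₀B, fun w hw => h.trans (hy2 w hw)⟩

/-- A vector of height at most `exp c` cannot have a very small linear form, since all dual norms
at the parameter `c / (1 - t - 2ε)` exceed `exp (-(t + ε) q)`. The value of the linear form is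
recorded as the parameter `p'` up to which the vector has small norm. -/
lemma exists_exit_time {ξ : Fin n → ℝ} {s t ε Q c p : ℝ} (hε : 0 < ε) (hs : 0 < n + s - ε)
    (htε : 0 < 1 - t - 2 * ε)
    (hA : ∀ q, Q ≤ q → ∀ w : Fin (n + 1) → ℤ, w ≠ 0 →
      Real.exp (-(t + ε) * q) ≤ dualNorm ξ q (toReal w))
    (hc : 0 < c) (hQ : Q * (1 - t - 2 * ε) ≤ c) {w : Fin (n + 1) → ℤ} (hw : w ≠ 0)
    (hX : ∀ i : Fin n, |toReal w i.succ| ≤ Real.exp c)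
    (hlin : |linForm ξ (toReal w)| ≤ Real.exp (-((n + s - ε) * p))) :
    ∃ p', p ≤ p' ∧ |linForm ξ (toReal w)| = Real.exp (-((n + s - ε) * p')) ∧
      p' ≤ (n + t + ε) * c / ((1 - t - 2 * ε) * (n + s - ε)) := by
  set q := c / (1 - t - 2 * ε) with hq
  have hqpos : 0 < q := div_pos hc htε
  have hcq : c = (1 - t - 2 * ε) * q := by rw [hq, mul_div_cancel₀ _ htε.ne']
  have hN := hA q (by rw [hq, le_div_iff₀ htε]; exact hQ) w hw
  have hlow : Real.exp (-(n + t + ε) * q) ≤ |linForm ξ (toReal w)| := by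
    by_contra hcon
    push Not at hcon
    obtain ⟨i, hi⟩ := exp_le_dualNorm_dichotomy hN (by
      refine hcon.trans_le (Real.exp_le_exp.2 ?_)
      linarith)
    have h1 := Real.exp_le_exp.1 (hi.trans (hX i))
    rw [hcq] at h1
    have : 0 < ε * q := mul_pos hε hqpos
    linarith
  have hpos : 0 < |linForm ξ (toReal w)| := (Real.exp_pos _).trans_le hlow
  have heq : |linForm ξ (toReal w)|
      = Real.exp (-((n + s - ε) * (-Real.log |linForm ξ (toReal w)| / (n + s - ε)))) := by
    rw [mul_div_cancel₀ _ hs.ne', neg_neg, Real.exp_log hpos]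
  set p' := -Real.log |linForm ξ (toReal w)| / (n + s - ε) with hp'
  refine ⟨p', ?_, heq, ?_⟩
  · rw [heq, Real.exp_le_exp] at hlin
    exact le_of_mul_le_mul_left (by linarith) hs
  · rw [heq, Real.exp_le_exp] at hlow
    have h2 : (n + t + ε) * c / ((1 - t - 2 * ε) * (n + s - ε)) = (n + t + ε) * q / (n + s - ε) := by
      rw [hq]
      field_simp
    rw [h2, le_div_iff₀ hs]
    linarith

/-! ### Three consecutive vectors -/

set_option maxHeartbeats 1000000 in
/-- The quantitative core, at one parameter `q₀` where a vector `x` nearly realizes `t`, with all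
asymptotic statements replaced by bounds with an error `ε`, and with `m` in the role of `-μ`.
The vector `y` is taken a factor `1 + η` after the time `q₁` at which `x` stops having norm at most
`exp (-(s - ε) q)`; the vector `z` is taken just after the corresponding time `q₂` of `y`. The number
`κ` bounds `q₁ / q₀`. The remaining hypotheses hold for small `ε` once `η` is small, if `s`, `t` and
`m` satisfy the equality of Schmidt and Summerer: `hlin_y` and `hlin_z` say that the coordinates of
`y` and of `z` outweigh their linear forms at `q₀`, `hminor` gives a lower bound for a `2 × 2` minor
of `x` and `y`, and `hplane₁`, `hplane₂` and `hplane₃` keep `z` out of the plane of `x` and `y`. -/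
lemma exponent_inequality_of_parameters {ξ : Fin n → ℝ} {r : ℕ} (hr : n = r + 2) {s t m ε η κ q₀ : ℝ}
    (hε : 0 < ε) (hst : s ≤ t) (hs0 : 0 ≤ s)
    (hη : 2 * ε < η) (hεt : 0 < 1 - t - 2 * ε) (hεs : 1 ≤ n + s - ε)
    (hκ : κ = (n + t + ε) * (1 - t + ε) / ((1 - t - 2 * ε) * (n + s - ε)))
    (hlin_y : -(n + s - ε) * (1 + η) + n < t - (n - 1) * m - (n + 1) * ε)
    (hminor : 0 ≤ (n + s - ε) * η + (t - (n - 1) * m - (n + 1) * ε) + 1 - (1 - t + ε) - ε)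
    (hplane₁ : -(n + s - ε) + (1 - s + ε) * (1 + ε) ≤ 0)
    (hplane₂ : 0 ≤ (-(n + s - ε) + (1 - s + ε) * (1 + ε)) * (1 + η) + (1 - s + ε) * (1 + η)
      + (n + s - ε))
    (hplane₃ : ((-(n + s - ε) + (1 - s + ε) * (1 + ε)) * (1 + η) + (1 - s + ε) * (1 + η)
      + (n + s - ε)) * κ + (-2 * t - 2 + 2 * (n - 1) * m + (2 * n + 3) * ε) < 0)
    (hlin_z : -(n + s - ε) + n
      < -ε + (t - ε) - ((1 - s + ε) * (1 + η) * κ - 1) - (n - 2) * (m + ε))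
    (hq₀ : 0 < q₀)
    (hA : ∀ q, q₀ ≤ q → ∀ w : Fin (n + 1) → ℤ, w ≠ 0 →
      Real.exp (-(t + ε) * q) ≤ dualNorm ξ q (toReal w))
    (hB : ∀ q, q₀ ≤ q → ∃ w : Fin (n + 1) → ℤ, w ≠ 0 ∧
      dualNorm ξ q (toReal w) ≤ Real.exp (-(s - ε) * q))
    (hC : ∃ w : Fin (n + 1) → ℤ, w ≠ 0 ∧ dualNorm ξ q₀ (toReal w) ≤ Real.exp (-(t - ε) * q₀))
    (hD : ∃ W : Fin (n + 1) → Fin (n + 1) → ℤ, LinearIndependent ℝ (fun i => toReal (W i)) ∧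
      ∀ i, dualNorm ξ q₀ (toReal (W i)) ≤ Real.exp ((m + ε) * q₀))
    (hfac : 4 * ((n + 1).factorial : ℝ) ≤ Real.exp (ε * q₀)) :
    2 + t - (1 - s + ε) * (1 + η) * κ - (n - 2) * m - n * ε ≤
      (1 - s + ε) * ((1 + ε) * ((n + t + ε) * ((1 - s + ε) * (1 + η) * κ)
        / ((1 - t - 2 * ε) * (n + s - ε)))) := by
  obtain ⟨x, hx0, hx⟩ := hC
  obtain ⟨W, hW, hWρ⟩ := hD
  have hrn : (r : ℝ) = n - 2 := by rw [hr]; push_cast; ring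
  have hη0 : 0 < η := by linarith
  have hfac1 : (1 : ℝ) ≤ (n + 1).factorial := by exact_mod_cast (n + 1).factorial_pos
  have hfacε : ((n + 1).factorial : ℝ) ≤ Real.exp (ε * q₀) := by linarith
  have hfour : 4 ≤ Real.exp (ε * q₀) := by linarith
  have hεq : 0 < ε * q₀ := mul_pos hε hq₀
  have hpos_s : 0 < n + s - ε := by linarith
  have hs1 : 0 < 1 - s + ε := by linarith
  -- the exit time `q₁` of `x`
  obtain ⟨hxlin, hxX⟩ := (dualNorm_le_exp_iff _ _ _ _).1 hx
  obtain ⟨q₁, hq01, hxA, hq1κ⟩ := exists_exit_time (p := q₀) (c := (1 - t + ε) * q₀) hε hpos_s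
    hεt hA (mul_pos (by linarith) hq₀) (by nlinarith) hx0
    (fun i => (hxX i).trans (Real.exp_le_exp.2 (by linarith)))
    (hxlin.trans (Real.exp_le_exp.2 (by nlinarith)))
  have hq1κ' : q₁ ≤ κ * q₀ := by
    refine hq1κ.trans (le_of_eq ?_)
    rw [hκ]
    ring
  have hq1pos : 0 < q₁ := hq₀.trans_le hq01
  have hηq1 : 0 < η * q₁ := mul_pos hη0 hq1pos
  set q₁' := (1 + η) * q₁ with hq1'
  have hq11' : q₁ ≤ q₁' := by rw [hq1']; linarith
  have hq01' : q₀ ≤ q₁' := hq01.trans hq11'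
  -- a nearly minimal vector `y` shortly after the exit time of `x`
  obtain ⟨y, hy0, hyN, hymin⟩ := exists_nearly_minimal_dualNorm (Real.exp_pos _)
    (hA q₁' hq01') (hB q₁' hq01')
  obtain ⟨hylin, hyX⟩ := (dualNorm_le_exp_iff _ _ _ _).1 hyN
  have hyX' : ∀ i : Fin n, |toReal y i.succ| ≤ Real.exp ((1 - s + ε) * q₁') := fun i =>
    (hyX i).trans (Real.exp_le_exp.2 (by linarith))
  have hylin' : |linForm ξ (toReal y)| ≤ Real.exp (-((n + s - ε) * q₁')) :=
    hylin.trans (Real.exp_le_exp.2 (by linarith))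
  -- a multiple of `x` at the later time `q₁'` would be so short that it violates `hA` at `q₀`
  have hxy : LinearIndependent ℝ ![toReal x, toReal y] := by
    rw [LinearIndependent.pair_iff' (by rwa [Ne, toReal_eq_zero])]
    intro β hβ
    have h1 : |β| * Real.exp (-((n + s - ε) * q₁)) ≤ Real.exp (-((n + s - ε) * q₁')) := by
      rw [← hxA, ← abs_mul, ← linForm_smul, hβ]
      exact hylin'
    have h2 : Real.exp (-(t + ε) * q₀) ≤ |β| * Real.exp (-(t - ε) * q₀) := by
      have := hA q₀ le_rfl y hy0
      rw [← hβ, dualNorm_smul] at this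
      exact this.trans (by gcongr)
    have h3 : Real.exp (-(t + ε) * q₀ + -((n + s - ε) * q₁))
        ≤ Real.exp (-(t - ε) * q₀ + -((n + s - ε) * q₁')) := by
      rw [Real.exp_add, Real.exp_add]
      calc Real.exp (-(t + ε) * q₀) * Real.exp (-((n + s - ε) * q₁))
          ≤ |β| * Real.exp (-(t - ε) * q₀) * Real.exp (-((n + s - ε) * q₁)) := by gcongr
        _ = Real.exp (-(t - ε) * q₀) * (|β| * Real.exp (-((n + s - ε) * q₁))) := by ring
        _ ≤ _ := by gcongr
    rw [Real.exp_le_exp] at h3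
    have h4 : 2 * ε * q₀ < (n + s - ε) * (η * q₁) := by
      calc 2 * ε * q₀ < η * q₀ := by gcongr
        _ ≤ η * q₁ := by gcongr
        _ ≤ _ := le_mul_of_one_le_left hηq1.le hεs
    have h5 : (n + s - ε) * q₁' = (n + s - ε) * q₁ + (n + s - ε) * (η * q₁) := by
      rw [hq1']
      ring
    linarith
  -- size of `y` at `q₀`
  -- the determinant of `x`, `y` and `n - 1` of the vectors `W` gives the lower bound
  set Y := (1 - s + ε) * q₁' - q₀ with hY
  set ℓ := t - (n - 1) * m - (n + 1) * ε with hℓ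
  have hyhi : dualNorm ξ q₀ (toReal y) ≤ Real.exp Y := by
    rw [dualNorm_le_exp_iff]
    refine ⟨hylin'.trans (Real.exp_le_exp.2 ?_), fun i => (hyX' i).trans (Real.exp_le_exp.2 ?_)⟩
    · have : (n + 1) * q₀ ≤ (n + 1) * q₁' := by gcongr
      rw [hY]
      linarith
    · rw [hY]
      linarith
  have hρpow : ∀ k : ℕ, Real.exp ((m + ε) * q₀) ^ k = Real.exp (k * ((m + ε) * q₀)) := fun k => by
    rw [← Real.exp_nat_mul]
  have hylow : Real.exp (ℓ * q₀) ≤ dualNorm ξ q₀ (toReal y) := by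
    have h1 := one_le_prod_norm_mul_pow (abs_det_dual ξ q₀) hW hWρ (k := 2) (r := r + 1) (by omega)
      (v := ![x, y]) (by
        convert hxy using 1
        ext i : 1
        fin_cases i <;> rfl)
    rw [Fin.prod_univ_two, hρpow] at h1
    change 1 ≤ _ * ((dualNorm ξ q₀ (toReal x) * dualNorm ξ q₀ (toReal y)) * _) at h1
    have h2 : 1 ≤ Real.exp (-(ℓ * q₀)) * dualNorm ξ q₀ (toReal y) := by
      calc 1 ≤ (n + 1).factorial * ((dualNorm ξ q₀ (toReal x) * dualNorm ξ q₀ (toReal y))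
            * Real.exp (↑(r + 1) * ((m + ε) * q₀))) := h1
        _ ≤ Real.exp (ε * q₀) * ((Real.exp (-(t - ε) * q₀) * dualNorm ξ q₀ (toReal y))
            * Real.exp (↑(r + 1) * ((m + ε) * q₀))) := by
            have hx_nonneg := (dualNorm_pos ξ q₀ hx0).le
            have hy_nonneg := (dualNorm_pos ξ q₀ hy0).le
            gcongr
        _ = Real.exp (ε * q₀ + -(t - ε) * q₀ + ↑(r + 1) * ((m + ε) * q₀))
            * dualNorm ξ q₀ (toReal y) := by
            rw [Real.exp_add, Real.exp_add]
            ring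
        _ = _ := by
            congr 2
            rw [hℓ]
            push_cast
            rw [hrn]
            ring
    rw [Real.exp_neg, ← div_eq_inv_mul, le_div_iff₀ (Real.exp_pos _), one_mul] at h2
    exact h2
  obtain ⟨i₀, hi₀⟩ := exp_le_dualNorm_dichotomy hylow (by
    refine hylin'.trans_lt (Real.exp_lt_exp.2 ?_)
    have h1 : (n + s - ε) * (1 + η) * q₀ ≤ (n + s - ε) * (1 + η) * q₁ := by gcongr
    have h2 := mul_lt_mul_of_pos_right hlin_y hq₀
    rw [hq1']
    linarith)
  -- the exit time `q₂` of `y`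
  obtain ⟨q₂, hq12, hyA, hq2κ⟩ := exists_exit_time (p := q₁') (c := (1 - s + ε) * q₁') hε hpos_s
    hεt hA (mul_pos hs1 (hq₀.trans_le hq01')) (by
      calc q₀ * (1 - t - 2 * ε) ≤ q₁' * (1 - s + ε) := by
            gcongr
            linarith
        _ = _ := mul_comm _ _) hy0 hyX' hylin'
  have hq02 : q₀ ≤ q₂ := hq01'.trans hq12
  set q₃ := (1 + ε) * q₂ with hq3
  have hq2pos : 0 < q₂ := hq₀.trans_le hq02
  have hεq2 : 0 < ε * q₂ := mul_pos hε hq2pos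
  have hq23 : q₂ ≤ q₃ := by rw [hq3]; linarith
  -- a vector `z` of small norm shortly after the exit time of `y`
  obtain ⟨z, hz0, hzN⟩ := hB q₃ (hq02.trans hq23)
  obtain ⟨hzlin, hzX⟩ := (dualNorm_le_exp_iff _ _ _ _).1 hzN
  have hzX' : ∀ i : Fin n, |toReal z i.succ| ≤ Real.exp ((1 - s + ε) * q₃) := fun i =>
    (hzX i).trans (Real.exp_le_exp.2 (by linarith))
  have hzlin' : |linForm ξ (toReal z)| ≤ Real.exp (-((n + s - ε) * q₃)) :=
    hzlin.trans (Real.exp_le_exp.2 (by linarith))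
  -- `z` is not on the line of `y`: the ratio would be at least `1/2` by near-minimality of `y`, while
  -- the linear form of `z` is smaller than that of `y` by at least the factor `exp (-ε q₂)`
  have hnotline : ∀ β : ℝ, toReal z ≠ β • toReal y := by
    intro β hβ
    have h1 : 1 ≤ 2 * |β| := by
      have h2 := hymin z hz0
      rw [hβ, dualNorm_smul, ← mul_assoc] at h2
      have h3 := dualNorm_pos ξ q₁' hy0
      exact le_of_mul_le_mul_right (by linarith) h3
    have h2 : |β| * Real.exp (-((n + s - ε) * q₂)) ≤ Real.exp (-((n + s - ε) * q₃)) := by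
      rw [← hyA, ← abs_mul, ← linForm_smul, ← hβ]
      exact hzlin'
    have h3 : Real.exp (-((n + s - ε) * q₃))
        = Real.exp (-((n + s - ε) * (ε * q₂))) * Real.exp (-((n + s - ε) * q₂)) := by
      rw [← Real.exp_add, hq3]
      ring_nf
    rw [h3] at h2
    have h4 := le_of_mul_le_mul_right h2 (Real.exp_pos _)
    have h5 : Real.exp (-((n + s - ε) * (ε * q₂))) ≤ Real.exp (-(ε * q₀)) := by
      apply Real.exp_le_exp.2
      have h6 : ε * q₀ ≤ ε * q₂ := by gcongr
      have h7 : ε * q₂ ≤ (n + s - ε) * (ε * q₂) := le_mul_of_one_le_left hεq2.le hεs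
      linarith
    have h6 : Real.exp (-(ε * q₀)) ≤ 1 / 4 := by
      rw [Real.exp_neg, one_div]
      exact inv_anti₀ (by norm_num) hfour
    linarith
  -- `z` is not in the plane of `x` and `y`: eliminating `y` from the linear form and from the
  -- coordinate `i₀` shows that the `x`-coordinate `α` of `z` is too small for the determinant of `z`,
  -- `y` and `n - 1` of the vectors `W` to be a non-zero integer
  have hnotplane : ∀ α β : ℝ, toReal z ≠ α • toReal x + β • toReal y := by
    intro α β hαβ
    have hzy : LinearIndependent ℝ ![toReal z, toReal y] := by
      rw [LinearIndependent.pair_symm_iff, LinearIndependent.pair_iff' (by rwa [Ne, toReal_eq_zero])]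
      intro γ hγ
      exact hnotline γ hγ.symm
    have h1 := one_le_abs_mul_of_eq_smul_add_smul (abs_det_dual ξ q₀) hW hWρ (r := r + 1)
      (by omega) hzy hαβ
    rw [hρpow] at h1
    change 1 ≤ _ * (_ * (dualNorm ξ q₀ (toReal x) * dualNorm ξ q₀ (toReal y) * _)) at h1
    have h2 : 1 ≤ |α| * Real.exp (ε * q₀ + -(t - ε) * q₀ + Y + ↑(r + 1) * ((m + ε) * q₀)) := by
      refine h1.trans ?_
      rw [Real.exp_add, Real.exp_add, Real.exp_add, mul_assoc (Real.exp (ε * q₀)),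
        mul_assoc (Real.exp (ε * q₀))]
      have hx_nonneg := (dualNorm_pos ξ q₀ hx0).le
      have hy_nonneg := (dualNorm_pos ξ q₀ hy0).le
      gcongr
    set E₁ := -((n + s - ε) * q₁) + (ℓ * q₀ + q₀) with hE1
    set E₃ := -((n + s - ε) * q₂) + (1 - s + ε) * q₃ with hE3
    set D := linForm ξ (toReal x) * toReal y i₀.succ - linForm ξ (toReal y) * toReal x i₀.succ
      with hD
    have hαD : α * D = linForm ξ (toReal z) * toReal y i₀.succ
        - linForm ξ (toReal y) * toReal z i₀.succ := by
      have h3 : toReal z i₀.succ = α * toReal x i₀.succ + β * toReal y i₀.succ := by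
        rw [hαβ]
        rfl
      rw [h3, hαβ, linForm_smul_add_smul, hD]
      ring
    have hDlow : Real.exp E₁ ≤ 2 * |D| := by
      have h3 : Real.exp E₁ ≤ |linForm ξ (toReal x) * toReal y i₀.succ| := by
        rw [abs_mul, hxA, hE1, Real.exp_add]
        gcongr
      have h4 : |linForm ξ (toReal y) * toReal x i₀.succ|
          ≤ Real.exp (-((n + s - ε) * q₁') + (1 - t + ε) * q₀) := by
        rw [abs_mul, Real.exp_add]
        refine mul_le_mul hylin' ((hxX i₀).trans (Real.exp_le_exp.2 (by linarith)))
          (abs_nonneg _) (Real.exp_pos _).le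
      have h5 : Real.exp (-((n + s - ε) * q₁') + (1 - t + ε) * q₀) * Real.exp (ε * q₀)
          ≤ Real.exp E₁ := by
        rw [← Real.exp_add, Real.exp_le_exp, hE1, hq1']
        have h6 : (n + s - ε) * η * q₀ ≤ (n + s - ε) * η * q₁ := by gcongr
        have h7 := mul_nonneg hminor hq₀.le
        linarith
      have h6 := abs_sub_abs_le_abs_sub (linForm ξ (toReal x) * toReal y i₀.succ)
        (linForm ξ (toReal y) * toReal x i₀.succ)
      rw [← hD] at h6
      have h7 := Real.exp_pos (-((n + s - ε) * q₁') + (1 - t + ε) * q₀)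
      have h8 : Real.exp (-((n + s - ε) * q₁') + (1 - t + ε) * q₀) * 4
          ≤ Real.exp (-((n + s - ε) * q₁') + (1 - t + ε) * q₀) * Real.exp (ε * q₀) := by gcongr
      linarith
    have hup : |α| * |D| ≤ 2 * Real.exp E₃ := by
      rw [← abs_mul, hαD]
      refine (abs_sub _ _).trans ?_
      rw [abs_mul, abs_mul]
      have h3 : |linForm ξ (toReal z)| * |toReal y i₀.succ| ≤ Real.exp E₃ := by
        calc _ ≤ Real.exp (-((n + s - ε) * q₃)) * Real.exp ((1 - s + ε) * q₁') :=
              mul_le_mul hzlin' (hyX' i₀) (abs_nonneg _) (Real.exp_pos _).le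
          _ = Real.exp (-((n + s - ε) * q₃) + (1 - s + ε) * q₁') := by rw [Real.exp_add]
          _ ≤ Real.exp E₃ := by
            apply Real.exp_le_exp.2
            rw [hE3]
            have h4 : (n + s - ε) * q₂ ≤ (n + s - ε) * q₃ := by gcongr
            have h5 : (1 - s + ε) * q₁' ≤ (1 - s + ε) * q₃ := by
              gcongr
              exact hq12.trans hq23
            linarith
      have h4 : |linForm ξ (toReal y)| * |toReal z i₀.succ| ≤ Real.exp E₃ := by
        rw [hE3, Real.exp_add]
        exact mul_le_mul hyA.le (hzX' i₀) (abs_nonneg _) (Real.exp_pos _).le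
      linarith
    have h3 : |α| * Real.exp E₁ ≤ Real.exp (E₃ + ε * q₀) := by
      rw [Real.exp_add E₃]
      calc |α| * Real.exp E₁ ≤ |α| * (2 * |D|) := by gcongr
        _ = 2 * (|α| * |D|) := by ring
        _ ≤ 2 * (2 * Real.exp E₃) := by gcongr
        _ = Real.exp E₃ * 4 := by ring
        _ ≤ _ := by gcongr
    have h4 : Real.exp E₁ ≤ Real.exp (E₃ + ε * q₀
        + (ε * q₀ + -(t - ε) * q₀ + Y + ↑(r + 1) * ((m + ε) * q₀))) := by
      rw [Real.exp_add (E₃ + ε * q₀)]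
      calc Real.exp E₁ = 1 * Real.exp E₁ := (one_mul _).symm
        _ ≤ |α| * Real.exp (ε * q₀ + -(t - ε) * q₀ + Y + ↑(r + 1) * ((m + ε) * q₀))
            * Real.exp E₁ := by gcongr
        _ = |α| * Real.exp E₁
            * Real.exp (ε * q₀ + -(t - ε) * q₀ + Y + ↑(r + 1) * ((m + ε) * q₀)) := by ring
        _ ≤ _ := by gcongr
    rw [Real.exp_le_exp] at h4
    have h5 : E₃ ≤ (-(n + s - ε) + (1 - s + ε) * (1 + ε)) * q₁' := by
      have h6 := mul_le_mul_of_nonpos_left hq12 hplane₁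
      rw [hE3, hq3]
      linarith
    have h6 := mul_le_mul_of_nonneg_left hq1κ' hplane₂
    have h7 := mul_lt_mul_of_pos_right hplane₃ hq₀
    rw [hE1, hY, hℓ] at h4
    push_cast at h4
    rw [hrn] at h4
    rw [hq1'] at h4 h5
    linarith
  -- hence `x`, `y`, `z` are independent and `z` is large at `q₀`
  have hxyz : LinearIndependent ℝ fun i => toReal ((![z, x, y] : Fin 3 → Fin (n + 1) → ℤ) i) := by
    have h1 : (fun i => toReal ((![z, x, y] : Fin 3 → Fin (n + 1) → ℤ) i))
        = Fin.cons (toReal z) ![toReal x, toReal y] := by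
      ext i : 1
      fin_cases i <;> rfl
    rw [h1, linearIndependent_finCons]
    refine ⟨hxy, fun hmem => ?_⟩
    rw [Matrix.range_cons, Matrix.range_cons, Matrix.range_empty, Set.union_empty,
      Set.singleton_union, Submodule.mem_span_pair] at hmem
    obtain ⟨α, β, h⟩ := hmem
    exact hnotplane α β h.symm
  set Z := -(ε * q₀) + (t - ε) * q₀ - Y - (n - 2) * ((m + ε) * q₀) with hZ
  have hzlow : Real.exp Z ≤ dualNorm ξ q₀ (toReal z) := by
    have h1 := one_le_prod_norm_mul_pow (abs_det_dual ξ q₀) hW hWρ (k := 3) (r := r) (by omega) hxyz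
    rw [Fin.prod_univ_three, hρpow] at h1
    change 1 ≤ _ * ((dualNorm ξ q₀ (toReal z) * dualNorm ξ q₀ (toReal x)
      * dualNorm ξ q₀ (toReal y)) * _) at h1
    have h2 : 1 ≤ Real.exp (-Z) * dualNorm ξ q₀ (toReal z) := by
      calc 1 ≤ (n + 1).factorial * ((dualNorm ξ q₀ (toReal z) * dualNorm ξ q₀ (toReal x)
            * dualNorm ξ q₀ (toReal y)) * Real.exp (r * ((m + ε) * q₀))) := h1
        _ ≤ Real.exp (ε * q₀) * ((dualNorm ξ q₀ (toReal z) * Real.exp (-(t - ε) * q₀)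
            * Real.exp Y) * Real.exp (r * ((m + ε) * q₀))) := by
            have hx_nonneg := (dualNorm_pos ξ q₀ hx0).le
            have hy_nonneg := (dualNorm_pos ξ q₀ hy0).le
            have hz_nonneg := (dualNorm_pos ξ q₀ hz0).le
            gcongr
        _ = Real.exp (ε * q₀ + -(t - ε) * q₀ + Y + r * ((m + ε) * q₀))
            * dualNorm ξ q₀ (toReal z) := by
            rw [Real.exp_add, Real.exp_add, Real.exp_add]
            ring
        _ = _ := by
            congr 2
            rw [hZ, hrn]
            ring
    rw [Real.exp_neg, ← div_eq_inv_mul, le_div_iff₀ (Real.exp_pos _), one_mul] at h2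
    exact h2
  have hYκ : Y ≤ ((1 - s + ε) * (1 + η) * κ - 1) * q₀ := by
    have h1 : (1 - s + ε) * (1 + η) * q₁ ≤ (1 - s + ε) * (1 + η) * (κ * q₀) := by gcongr
    rw [hY, hq1']
    linarith
  obtain ⟨i, hi⟩ := exp_le_dualNorm_dichotomy hzlow (by
    refine hzlin'.trans_lt (Real.exp_lt_exp.2 ?_)
    have h1 : (n + s - ε) * q₀ ≤ (n + s - ε) * q₃ := by
      gcongr
      exact hq02.trans hq23
    have h2 := mul_lt_mul_of_pos_right hlin_z hq₀
    rw [hZ]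
    linarith)
  have hfin : Z + q₀ ≤ (1 - s + ε) * q₃ := Real.exp_le_exp.1 (hi.trans (hzX' i))
  have hq2κ' : q₂ ≤ (n + t + ε) * ((1 - s + ε) * (1 + η) * κ)
      / ((1 - t - 2 * ε) * (n + s - ε)) * q₀ := by
    have ht0 : 0 ≤ n + t + ε := by
      have : (0 : ℝ) ≤ n := by positivity
      linarith
    refine hq2κ.trans ?_
    rw [div_mul_eq_mul_div]
    refine div_le_div_of_nonneg_right ?_ (mul_pos hεt hpos_s).le
    have h1 : (n + t + ε) * ((1 - s + ε) * (1 + η)) * q₁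
        ≤ (n + t + ε) * ((1 - s + ε) * (1 + η)) * (κ * q₀) := by gcongr
    rw [hq1']
    linarith
  have hq3κ : (1 - s + ε) * q₃ ≤ (1 - s + ε) * ((1 + ε) * ((n + t + ε) * ((1 - s + ε) * (1 + η) * κ)
      / ((1 - t - 2 * ε) * (n + s - ε)) * q₀)) := by
    rw [hq3]
    gcongr
  refine le_of_mul_le_mul_right ?_ hq₀
  rw [hZ] at hfin
  linarith

/-! ### The inequality between the exponents -/

lemma eventually_nhdsGT_lt {f g : ℝ → ℝ} (hf : ContinuousAt f 0) (hg : ContinuousAt g 0)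
    (h : f 0 < g 0) : ∀ᶠ ε in 𝓝[>] (0 : ℝ), f ε < g ε :=
  (hf.eventually_lt hg h).filter_mono nhdsWithin_le_nhds

/-- The main inequality in the non-degenerate range `0 < s ≤ t < 1`: pass to the limit, first in
`ε` and then in `η`. -/
lemma key_inequality_of_lt_one (hn : 2 ≤ n) {ξ : Fin n → ℝ} {s t m : ℝ}
    (ht : phiUpper ξ (n + 1) = t) (hs : phiLower ξ (n + 1) = s) (hm : phiLower ξ 1 = -m)
    (hs0 : 0 < s) (hst : s ≤ t) (ht1 : t < 1)
    (heq : (n - 1) * m * (n + s) = (n - 1) * t + s * (n + 1 + 2 * t)) :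
    (1 + m) * (1 - t) * (n + s) ^ 2 ≤ (1 - s) ^ 2 * (n + t) ^ 2 := by
  by_contra hcon
  push Not at hcon
  have hn2 : (2 : ℝ) ≤ n := by exact_mod_cast hn
  obtain ⟨r, hr⟩ : ∃ r, n = r + 2 := ⟨n - 2, by omega⟩
  have hns : 0 < n + s := by linarith
  have h1t : 0 < 1 - t := by linarith
  have h1s : 0 < 1 - s := by linarith
  set K := (n + t) / (n + s) with hK
  have hKmul : K * (n + s) = n + t := div_mul_cancel₀ _ hns.ne'
  have hK1 : 1 ≤ K := by
    rw [hK, one_le_div hns]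
    linarith
  -- the equality says that the bounds used at `q₀` leave no slack
  have hmK : (n - 1) * m = 1 + t - (1 - s) * K := by
    apply mul_right_cancel₀ hns.ne'
    linear_combination heq + (1 - s) * hKmul
  have hm0 : 0 < m := by
    have h1 : 0 < (n - 1) * m * (n + s) := by
      rw [heq]
      have : 0 ≤ (n - 1 : ℝ) * t := mul_nonneg (by linarith) (by linarith)
      have : 0 < s * (n + 1 + 2 * t) := mul_pos hs0 (by linarith)
      linarith
    have h2 : 0 < (n - 1) * m := pos_of_mul_pos_left h1 hns.le
    exact pos_of_mul_pos_right h2 (by linarith)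
  have hstrict : (1 - s) ^ 2 * K ^ 2 / (1 - t) < 1 + m := by
    rw [div_lt_iff₀ h1t]
    apply lt_of_mul_lt_mul_right _ (by positivity : 0 ≤ (n + s) ^ 2)
    calc (1 - s) ^ 2 * K ^ 2 * (n + s) ^ 2 = (1 - s) ^ 2 * (K * (n + s)) ^ 2 := by ring
      _ = (1 - s) ^ 2 * (n + t) ^ 2 := by rw [hKmul]
      _ < _ := hcon
  -- the delay `η` of the second vector
  obtain ⟨η, hη0, hη1, hη2, hη3⟩ : ∃ η : ℝ, 0 < η ∧
      (1 - s) ^ 2 * K ^ 2 * (1 + η) / (1 - t) < 1 + m - (1 - s) * η * K ∧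
      (1 - s) * η * K < m + s ∧ η * (n - 2 + 3 * s) < 2 * (1 - s) := by
    have e1 : ∀ᶠ η in 𝓝[>] (0 : ℝ),
        (1 - s) ^ 2 * K ^ 2 * (1 + η) / (1 - t) < 1 + m - (1 - s) * η * K :=
      eventually_nhdsGT_lt (by fun_prop) (by fun_prop) (by simpa using hstrict)
    have e2 : ∀ᶠ η in 𝓝[>] (0 : ℝ), (1 - s) * η * K < m + s :=
      eventually_nhdsGT_lt (by fun_prop) (by fun_prop) (by simp; linarith)
    have e3 : ∀ᶠ η in 𝓝[>] (0 : ℝ), η * (n - 2 + 3 * s) < 2 * (1 - s) :=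
      eventually_nhdsGT_lt (by fun_prop) (by fun_prop) (by simp; linarith)
    obtain ⟨η, ⟨⟨h1, h2⟩, h3⟩, h0⟩ := (((e1.and e2).and e3).and self_mem_nhdsWithin).exists
    exact ⟨η, h0, h1, h2, h3⟩
  have hnsη : 0 < (n + s) * η := mul_pos hns hη0
  have hsK : 1 - s ≤ (1 - s) * K := le_mul_of_one_le_right h1s.le hK1
  obtain ⟨κ, hκ⟩ : ∃ κ : ℝ → ℝ, κ = fun ε =>
    (n + t + ε) * (1 - t + ε) / ((1 - t - 2 * ε) * (n + s - ε)) := ⟨_, rfl⟩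
  have hden : (1 - t - 2 * 0) * (n + s - 0) ≠ 0 := by
    simpa using ⟨h1t.ne', hns.ne'⟩
  have hκc : ContinuousAt κ 0 := by
    rw [hκ]
    exact ContinuousAt.div (by fun_prop) (by fun_prop) hden
  have hκ0 : κ 0 = K := by
    rw [hκ, hK]
    simp only [add_zero, sub_zero, mul_zero]
    rw [mul_comm (1 - t)]
    exact mul_div_mul_right _ _ h1t.ne'
  have e1 : ∀ᶠ ε in 𝓝[>] (0 : ℝ), 2 * ε < η :=
    eventually_nhdsGT_lt (by fun_prop) (by fun_prop) (by simpa using hη0)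
  have e2 : ∀ᶠ ε in 𝓝[>] (0 : ℝ), 0 < 1 - t - 2 * ε :=
    eventually_nhdsGT_lt (by fun_prop) (by fun_prop) (by simpa using ht1)
  have e3 : ∀ᶠ ε in 𝓝[>] (0 : ℝ), 1 < n + s - ε :=
    eventually_nhdsGT_lt (by fun_prop) (by fun_prop) (by simp; linarith)
  have e4 : ∀ᶠ ε in 𝓝[>] (0 : ℝ),
      -(n + s - ε) * (1 + η) + n < t - (n - 1) * m - (n + 1) * ε :=
    eventually_nhdsGT_lt (by fun_prop) (by fun_prop) (by rw [hmK]; linarith)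
  have e5 : ∀ᶠ ε in 𝓝[>] (0 : ℝ),
      0 < (n + s - ε) * η + (t - (n - 1) * m - (n + 1) * ε) + 1 - (1 - t + ε) - ε :=
    eventually_nhdsGT_lt (by fun_prop) (by fun_prop) (by rw [hmK]; linarith)
  have e6 : ∀ᶠ ε in 𝓝[>] (0 : ℝ), -(n + s - ε) + (1 - s + ε) * (1 + ε) < 0 :=
    eventually_nhdsGT_lt (by fun_prop) (by fun_prop) (by linarith)
  have e7 : ∀ᶠ ε in 𝓝[>] (0 : ℝ), 0 < (-(n + s - ε) + (1 - s + ε) * (1 + ε)) * (1 + η)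
      + (1 - s + ε) * (1 + η) + (n + s - ε) :=
    eventually_nhdsGT_lt (by fun_prop) (by fun_prop) (by linarith)
  have e8 : ∀ᶠ ε in 𝓝[>] (0 : ℝ), ((-(n + s - ε) + (1 - s + ε) * (1 + ε)) * (1 + η)
      + (1 - s + ε) * (1 + η) + (n + s - ε)) * κ ε
      + (-2 * t - 2 + 2 * (n - 1) * m + (2 * n + 3) * ε) < 0 := by
    refine eventually_nhdsGT_lt (by fun_prop) (by fun_prop) ?_
    have h1 : 0 < η * (n - 2 + 3 * s) * K :=
      mul_pos (mul_pos hη0 (by linarith)) (by linarith)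
    rw [hκ0, mul_assoc 2, hmK]
    linarith
  have e9 : ∀ᶠ ε in 𝓝[>] (0 : ℝ), -(n + s - ε) + n
      < -ε + (t - ε) - ((1 - s + ε) * (1 + η) * κ ε - 1) - (n - 2) * (m + ε) := by
    refine eventually_nhdsGT_lt (by fun_prop) (by fun_prop) ?_
    rw [hκ0]
    linarith
  have e10 : ∀ᶠ ε in 𝓝[>] (0 : ℝ),
      (1 - s + ε) * ((1 + ε) * ((n + t + ε) * ((1 - s + ε) * (1 + η) * κ ε)
        / ((1 - t - 2 * ε) * (n + s - ε))))
      < 2 + t - (1 - s + ε) * (1 + η) * κ ε - (n - 2) * m - n * ε := by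
    refine eventually_nhdsGT_lt ?_ (by fun_prop) ?_
    · have h1 : ContinuousAt (fun ε => (n + t + ε) * ((1 - s + ε) * (1 + η) * κ ε)
          / ((1 - t - 2 * ε) * (n + s - ε))) 0 :=
        ContinuousAt.div (by fun_prop) (by fun_prop) hden
      fun_prop
    · rw [hκ0]
      have h1 : (1 - s + 0) * ((1 + 0) * ((n + t + 0) * ((1 - s + 0) * (1 + η) * K)
          / ((1 - t - 2 * 0) * (n + s - 0)))) = (1 - s) ^ 2 * K ^ 2 * (1 + η) / (1 - t) := by
        simp only [add_zero, sub_zero, mul_zero, one_mul]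
        rw [← hKmul]
        field_simp
      rw [h1]
      linarith
  obtain ⟨ε, ⟨⟨⟨⟨⟨⟨⟨⟨⟨⟨c1, c2⟩, c3⟩, c4⟩, c5⟩, c6⟩, c7⟩, c8⟩, c9⟩, c10⟩, hε⟩⟩ :=
    ((((((((((e1.and e2).and e3).and e4).and e5).and e6).and e7).and e8).and e9).and e10).and
      self_mem_nhdsWithin).exists
  have hε : 0 < ε := hε
  have fA := eventually_forall_ge_atTop.2
    (eventually_exp_le_dualNorm (ξ := ξ) (τ := t + ε) (by rw [ht]; linarith))
  have fB := eventually_forall_ge_atTop.2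
    (eventually_exists_dualNorm_le (ξ := ξ) (σ := s - ε) (by rw [hs]; linarith))
  have fC := frequently_exists_dualNorm_le (ξ := ξ) (σ := t - ε) (by rw [ht]; linarith)
  have fD := eventually_exists_linearIndependent_dualNorm_le (ξ := ξ) (ν := -(m + ε))
    (by rw [hm]; linarith)
  obtain ⟨q₀, hC, ⟨⟨hA, hB⟩, hD⟩, hq₀, hfac⟩ := (fC.and_eventually (((fA.and fB).and fD).and
    ((eventually_gt_atTop 0).and
      (eventually_le_exp_mul (4 * ((n + 1).factorial : ℝ)) hε)))).exists
  simp only [neg_neg] at hD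
  have := exponent_inequality_of_parameters hr hε hst hs0.le c1 c2 c3.le (congrFun hκ ε) c4 c5.le c6.le c7.le c8 c9
    hq₀ hA hB hC hD hfac
  linarith

/-- If the Schmidt–Summerer inequality is an equality, then the three exponents satisfy a further
inequality. -/
lemma key_inequality (hn : 2 ≤ n) {ξ : Fin n → ℝ} {s t m : ℝ}
    (ht : phiUpper ξ (n + 1) = t) (hs : phiLower ξ (n + 1) = s) (hm : phiLower ξ 1 = -m)
    (ht1 : t ≤ 1)
    (heq : (n - 1) * m * (n + s) = (n - 1) * t + s * (n + 1 + 2 * t)) :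
    (1 + m) * (1 - t) * (n + s) ^ 2 ≤ (1 - s) ^ 2 * (n + t) ^ 2 := by
  have hs0 : 0 ≤ s := hs ▸ phiLower_last_nonneg ξ
  have hst : s ≤ t := hs ▸ ht ▸ phiLower_le_phiUpper ξ (by omega) le_rfl
  have hn2 : (2 : ℝ) ≤ n := by exact_mod_cast hn
  rcases ht1.eq_or_lt with rfl | ht1
  · simp only [sub_self, mul_zero, zero_mul]
    positivity
  rcases hs0.eq_or_lt with rfl | hs0
  · have h1 : m * n = t := by
      apply mul_left_cancel₀ (show (n - 1 : ℝ) ≠ 0 by linarith)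
      linear_combination heq
    have h2 : (1 + m) * (1 - t) * (n + 0) ^ 2 = (n + t) * ((1 - t) * n) := by
      linear_combination (1 - t) * n * h1
    rw [h2, sub_zero, one_pow, one_mul, sq]
    have h3 : (1 - t) * n ≤ n + t := by nlinarith
    exact mul_le_mul_of_nonneg_left h3 (by linarith)
  · exact key_inequality_of_lt_one hn ht hs hm hs0 hst ht1 heq

/-- The determinant of one vector realizing `t` and `n` further vectors of size `-μ`. -/
lemma phiUpper_add_mul_phiLower_nonpos (ξ : Fin n → ℝ) :
    phiUpper ξ (n + 1) + n * phiLower ξ 1 ≤ 0 := by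
  by_contra hcon
  push Not at hcon
  set c := phiUpper ξ (n + 1) + n * phiLower ξ 1 with hc
  set ε := c / (2 * (n + 1)) with hε
  have hn : (0 : ℝ) < n + 1 := by positivity
  have hεpos : 0 < ε := by positivity
  have hεc : ε * (n + 1) = c / 2 := by
    rw [hε]
    field_simp
  have fC := frequently_exists_dualNorm_le (ξ := ξ) (σ := phiUpper ξ (n + 1) - ε) (by linarith)
  have fD := eventually_exists_linearIndependent_dualNorm_le (ξ := ξ) (ν := phiLower ξ 1 - ε)
    (by linarith)
  obtain ⟨q, ⟨x, hx0, hx⟩, ⟨W, hW, hWρ⟩, hfac⟩ := (fC.and_eventually (fD.and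
    (eventually_le_exp_mul (((n + 1).factorial : ℝ) + 1) (half_pos hcon)))).exists
  have h1 := one_le_prod_norm_mul_pow (abs_det_dual ξ q) hW hWρ (k := 1) (r := n) (by omega)
    (v := fun _ => x) (linearIndependent_unique_iff.2 (by simpa [toReal_eq_zero] using hx0))
  rw [Fin.prod_univ_one, ← Real.exp_nat_mul] at h1
  change 1 ≤ _ * (dualNorm ξ q (toReal x) * _) at h1
  have hfacpos : (0 : ℝ) < (n + 1).factorial := by exact_mod_cast (n + 1).factorial_pos
  have h2 : 1 ≤ (n + 1).factorial * Real.exp (-(c / 2 * q)) := by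
    calc 1 ≤ (n + 1).factorial * (dualNorm ξ q (toReal x)
          * Real.exp (n * (-(phiLower ξ 1 - ε) * q))) := h1
      _ ≤ (n + 1).factorial * (Real.exp (-(phiUpper ξ (n + 1) - ε) * q)
          * Real.exp (n * (-(phiLower ξ 1 - ε) * q))) := by gcongr
      _ = (n + 1).factorial * Real.exp (-(c / 2 * q)) := by
          rw [← Real.exp_add]
          congr 2
          linear_combination q * hεc - q * hc
  rw [Real.exp_neg, ← div_eq_mul_inv, le_div_iff₀ (Real.exp_pos _), one_mul] at h2
  linarith

/-- In terms of `μ`, the inequality between `s` and `t` becomes quadratic, with `μ₀` as the larger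
root. -/
lemma mu0_le_of_key_inequality (hn : 2 ≤ n) {s t μ : ℝ} (hs0 : 0 ≤ s) (ht0 : 0 ≤ t) (ht1 : t ≤ 1)
    (hs1 : s ≤ 1) (heq : n * μ + t
      = -s * ((n + 1) / (n - 1) + μ + 2 / (n - 1) * t))
    (hkey : (1 + -μ) * (1 - t) * (n + s) ^ 2 ≤ (1 - s) ^ 2 * (n + t) ^ 2) :
    mu0 n t ≤ μ := by
  have hn2 : (2 : ℝ) ≤ n := by exact_mod_cast hn
  have hn1 : (0 : ℝ) < n - 1 := by linarith
  have hns : 0 < n + s := by linarith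
  have hnt : 0 < n + t := by linarith
  set D := n + 1 + 2 * t + (n - 1) * μ with hD
  set P := 1 + t + (n - 1) * μ with hP
  have heq' : (n - 1) * (n * μ + t) = -s * (n + 1 + (n - 1) * μ + 2 * t) := by
    rw [heq]
    field_simp
  have hDs : D * (n + s) = (n + 1) * (n + t) := by
    rw [hD]
    linear_combination heq'
  have hDpos : 0 < D := pos_of_mul_pos_left (hDs ▸ mul_pos (by linarith) hnt) hns.le
  have hDP : D * (1 - s) = (n + 1) * P := by
    rw [hD, hP]
    linear_combination -heq'
  have hP0 : 0 ≤ P := by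
    have : 0 ≤ (n + 1) * P := hDP ▸ mul_nonneg hDpos.le (by linarith)
    exact nonneg_of_mul_nonneg_right this (by linarith)
  have hquad : (1 - μ) * (1 - t) ≤ P ^ 2 := by
    have hpos : 0 < ((n + 1) * (n + t)) ^ 2 := by positivity
    refine le_of_mul_le_mul_right ?_ hpos
    calc (1 - μ) * (1 - t) * ((n + 1) * (n + t)) ^ 2
        = D ^ 2 * ((1 + -μ) * (1 - t) * (n + s) ^ 2) := by rw [← hDs]; ring
      _ ≤ D ^ 2 * ((1 - s) ^ 2 * (n + t) ^ 2) := by gcongr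
      _ = (D * (1 - s)) ^ 2 * (n + t) ^ 2 := by ring
      _ = _ := by rw [hDP]; ring
  rw [mu0, div_le_iff₀ (by positivity)]
  -- `(2 (n - 1) P + (1 - t))² - 4 (n - 1)² (P² - (1 - μ) (1 - t))` is the radicand in `μ₀`
  have hsqrt : Real.sqrt ((1 - t) * ((4 * (n : ℝ) - 5) * t + 4 * (n : ℝ) ^ 2 - 4 * n + 1))
      ≤ 2 * (n - 1) * P + (1 - t) := by
    rw [Real.sqrt_le_iff]
    constructor
    · have := mul_nonneg hn1.le hP0
      linarith
    · have h1 := mul_le_mul_of_nonneg_left hquad (by positivity : (0 : ℝ) ≤ 4 * (n - 1) ^ 2)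
      rw [hP] at h1 ⊢
      linarith
  rw [hP] at hsqrt
  linarith

end ParamGeom

theorem theorem5p3 (n : ℕ) (hn : 2 ≤ n) (t : ℝ) (ht : t ∈ Set.Icc (0 : ℝ) 1) (μ : ℝ)
    (hμ : μ ∉ Set.Icc (ParamGeom.mu0 n t) (-t / n)) :
    {ξ : Fin n → ℝ | ParamGeom.phiUpper ξ (n + 1) = t ∧ ParamGeom.phiLower ξ 1 = μ ∧
        ParamGeom.SS1Equality ξ} = ∅ ∧
    ((n : ℝ) + 1 + 2 * t + ((n : ℝ) - 1) * μ ≠ 0 →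
      ¬ ∃ ξ : Fin n → ℝ, ParamGeom.phiUpper ξ (n + 1) = t ∧
        ParamGeom.phiLower ξ (n + 1)
          = (1 - (n : ℝ)) * ((t + n * μ) / ((n : ℝ) + 1 + 2 * t + ((n : ℝ) - 1) * μ)) ∧
        ParamGeom.phiLower ξ 1 = μ) := by

  have hn2 : (2 : ℝ) ≤ n := by exact_mod_cast hn
  have hn1 : (0 : ℝ) < n - 1 := by linarith
  have hmain : ∀ ξ : Fin n → ℝ, ParamGeom.phiUpper ξ (n + 1) = t → ParamGeom.phiLower ξ 1 = μ →
      ¬ ParamGeom.SS1Equality ξ := by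
    intro ξ hξt hξμ hξ
    have hs0 := ParamGeom.phiLower_last_nonneg ξ
    have hst := ParamGeom.phiLower_le_phiUpper ξ (j := n + 1) (by omega) le_rfl
    have hup := ParamGeom.phiUpper_add_mul_phiLower_nonpos ξ
    rw [ParamGeom.SS1Equality, hξt, hξμ] at hξ
    rw [hξt] at hst hup
    rw [hξμ] at hup
    have hkey := ParamGeom.key_inequality hn hξt rfl (m := -μ) (by rw [hξμ, neg_neg]) ht.2 (by
      have h1 : (n - 1) * (n * μ + t) = -ParamGeom.phiLower ξ (n + 1)
          * (n + 1 + (n - 1) * μ + 2 * t) := by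
        rw [hξ]
        field_simp
      linear_combination -h1)
    apply hμ
    refine ⟨ParamGeom.mu0_le_of_key_inequality hn hs0 ht.1 ht.2 (hst.trans ht.2) hξ hkey, ?_⟩
    rw [le_div_iff₀ (by linarith)]
    linarith
  constructor
  · rw [Set.eq_empty_iff_forall_notMem]
    rintro ξ ⟨h1, h2, h3⟩
    exact hmain ξ h1 h2 h3
  · rintro hD ⟨ξ, h1, h2, h3⟩
    refine hmain ξ h1 h3 ?_
    rw [ParamGeom.SS1Equality, h1, h2, h3]
    have hfac : ((n : ℝ) + 1) / (n - 1) + μ + 2 / (n - 1) * t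
        = (n + 1 + 2 * t + (n - 1) * μ) / (n - 1) := by
      field_simp
      ring
    rw [hfac, mul_div_assoc', eq_div_iff hn1.ne', ← neg_mul, mul_assoc, div_mul_cancel₀ _ hD]
    ring
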